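/- **Setting.** Let $A\in\mathbb R^{n\times m}$, $0\ne b\in\mathbb R^n$, $c\in\mathbb R^m$, and suppose that $AA^T$ is positive definite and that $\lambda_{\min}>0$ is a lower bound on its eigenvalues. Let $T\ge 1$ be such that $\|y\|_\infty\le T$ and $\|s\|_\infty\le T$ whenever $s=c-A^Ty\ge 0$. Let $y^0\in\mathbb R^n$ satisfy $A^Ty^0<c$ (entrywise), and let $0<\varepsilon<1$. Put $s^0=c-A^Ty^0$, let $s^0_{\min}$ be its smallest entry, and let $U$ be the largest absolute value of an entry of $A,b,c$. Capital letters $S,\tilde S,\dots$ denote the diagonal matrices of the vectors $s,\tilde s,\dots$; $\|\cdot\|$ is the Euclidean norm and $\|v\|_M=\sqrt{v^TMv}$. $\mathtt{Solve}$ is an arbitrary solver that satisfies $\|\mathtt{Solve}(M,r,\delta)-M^{-1}r\|_M\le\delta\,\|M^{-1}r\|_M$ for all positive definite $M\in\mathbb R^{n\times n}$, all $r\in\mathbb R^n$ and all $\delta>0$. **The algorithm** $\mathtt{InteriorPoint}(A,b,c,\lambda_{\min},T,y^0,\varepsilon)$. * For a matrix $B$ with $k$ columns, $\mathtt{NewtonStep}(B,g,y)$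 sets $s=g-B^Ty$ and $\delta=\frac1{20(\sqrt k+1)}$, and returns $y+(1-\delta)\,\mathtt{Solve}(BS^{-2}B^T,-BS^{-1}\mathbf 1,\delta)$. * For $d\in\mathbb R^n$, the move in direction $d$ to level $z^+$ replaces $y$ by $y^+=\mathtt{NewtonStep}\big([A,\,-d\mathbf 1_m^T],\,(c,-z^+\mathbf 1_m),\,y\big)$, $s$ by $c-A^Ty^+$, the gap by $d^Ty^+-z^+$, and $z$ by $z^+$. * Phase 1: let $\hat b=A(S^0)^{-1}\mathbf 1_m$; start at $y=y^0$ with gap $\hat s_{gap}=m$ and $\hat z=\hat b^Ty^0-m$. While $\hat s_{gap}<40\lambda_{\min}^{-1/2}Tm\|\hat b\|$, move in direction $\hat b$ to level $\hat z-\hat s_{gap}/(10\sqrt m)$. * Phase 2: with the resulting $y$, $s=c-A^Ty$, put $z=b^Ty-40\lambda_{\min}^{-1/2}Tm\|b\|$ and $s_{gap}=b^Ty-z$. While $s_{gap}>\varepsilon/3$, move in direction $b$ to level $z+s_{gap}/(10\sqrt m)$. * Output: with $\tilde A=[A,\,-b\mathbf 1_m^T]$, $\tilde s=(s,s_{gap}\mathbf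 1_m)$, let $v=\mathtt{Solve}\big(\tilde A\tilde S^{-2}\tilde A^T,\tilde A\tilde S^{-1}\mathbf 1_{2m},\varepsilon_4\big)$, where $\varepsilon_4=\min\big(1,\frac{\min_k\tilde s_k}{TU}\cdot\frac{\sqrt m}{n}\big)$. Return $x=\dfrac{S^{-1}\mathbf 1_m-S^{-2}A^Tv}{m\,(s_{gap}^{-1}+s_{gap}^{-2}b^Tv)}$. **Theorem.** There is an absolute constant $C>0$ such that, for all data as above, both loops terminate; the primal program $\min\{c^Tx:Ax=b,\ x\ge0\}$ and the dual program $\max\{b^Ty:A^Ty+s=c,\ s\ge 0\}$ attain a common optimal value $z^*$; the output satisfies $$x>0,\qquad \|Ax-b\|\le\varepsilon,\qquad c^Tx<z^*+\varepsilon ;$$ and the solver calls made by the algorithm satisfy the following. 1. Their number is at most $C\sqrt m\,\log\dfrac{TUm}{\sqrt{\lambda_{\min}}\;\min(1,s^0_{\min})\,\varepsilon}$. 2. Every call but the last one requests accuracy $\varepsilon'=\dfrac{1}{20(\sqrt{2m}+1)}$. 3. Every call has the form $\mathtt{Solve}(AS^{-2}A^T+vv^T,\cdot,\varepsilon')$ with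 $\varepsilon'>0$, some positive diagonal matrix $S$ and some vector $v$ such that the condition number of $S$ is at most $C\,\dfrac{T^2Um^2}{s^0_{\min}\,\varepsilon}$ and $$\log\frac{\|v\|}{\varepsilon'}\le C\log\frac{TUm}{\min(1,s^0_{\min})\,\min(\varepsilon,\|b\|)}$$ (if $v=0$, the left side is read as $0$). -/

import Mathlib

open Matrix

namespace InteriorPt

/-- The Euclidean norm of a coordinate vector. -/
noncomputable def enorm2 {n : ℕ} (v : Fin n → ℝ) : ℝ := √(v ⬝ᵥ v)

/-- The matrix norm `‖v‖_M = √(vᵀ M v)`. -/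
noncomputable def matNorm {n : ℕ} (M : Matrix (Fin n) (Fin n) ℝ) (v : Fin n → ℝ) : ℝ :=
  √(v ⬝ᵥ M *ᵥ v)

/-- A linear system solver: `solve M b ε` is its answer to the system `M x = b` with
requested accuracy `ε`. -/
abbrev Solver (n : ℕ) : Type :=
  Matrix (Fin n) (Fin n) ℝ → (Fin n → ℝ) → ℝ → (Fin n → ℝ)

/-- The guarantee of an approximate solver: `‖x - M⁻¹ b‖_M ≤ ε ‖M⁻¹ b‖_M`. -/
def IsApproxSolver {n : ℕ} (solve : Solver n) : Prop :=
  ∀ (M : Matrix (Fin n) (Fin n) ℝ) (b : Fin n → ℝ) (ε : ℝ), M.PosDef → 0 < ε →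
    matNorm M (solve M b ε - M⁻¹ *ᵥ b) ≤ ε * matNorm M (M⁻¹ *ᵥ b)

/-- One call `Solve(mat, rhs, acc)` to the solver. -/
structure Query (n : ℕ) where
  mat : Matrix (Fin n) (Fin n) ℝ
  rhs : Fin n → ℝ
  acc : ℝ

/-- The answer of the solver to a call. -/
def Query.answer {n : ℕ} (q : Query n) (solve : Solver n) : Fin n → ℝ :=
  solve q.mat q.rhs q.acc

/-- The matrix `A S⁻² Aᵀ`, where `S` is the diagonal matrix with diagonal `s`. -/
noncomputable def scaledGram {n : ℕ} {κ : Type} [Fintype κ] [DecidableEq κ]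
    (A : Matrix (Fin n) κ ℝ) (s : κ → ℝ) : Matrix (Fin n) (Fin n) ℝ :=
  A * Matrix.diagonal (fun j => (s j ^ 2)⁻¹) * Aᵀ

/-- The solver call made by `NewtonStep(A, c, y)`. -/
noncomputable def newtonQuery {n : ℕ} {κ : Type} [Fintype κ] [DecidableEq κ]
    (A : Matrix (Fin n) κ ℝ) (c : κ → ℝ) (y : Fin n → ℝ) : Query n where
  mat := scaledGram A (c - Aᵀ *ᵥ y)
  rhs := -(A *ᵥ fun j => ((c - Aᵀ *ᵥ y) j)⁻¹)
  acc := 1 / (20 * (√(Fintype.card κ : ℝ) + 1))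

/-- `NewtonStep(A, c, y) = y + (1 - ε₃) d_y`. -/
noncomputable def newtonStep {n : ℕ} {κ : Type} [Fintype κ] [DecidableEq κ] (solve : Solver n)
    (A : Matrix (Fin n) κ ℝ) (c : κ → ℝ) (y : Fin n → ℝ) : Fin n → ℝ :=
  y + (1 - (newtonQuery A c y).acc) • (newtonQuery A c y).answer solve

/-- The matrix `Ã = [A, -d 1ᵀ]`, with `m` copies of the column `-d`. -/
def extMat {n m : ℕ} (A : Matrix (Fin n) (Fin m) ℝ) (d : Fin n → ℝ) :
    Matrix (Fin n) (Fin m ⊕ Fin m) ℝ :=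
  Matrix.fromCols A (Matrix.of fun i _ => -d i)

/-- The vector `[s ; t 1]`, with `m` copies of `t`. -/
def extVec {m : ℕ} (s : Fin m → ℝ) (t : ℝ) : Fin m ⊕ Fin m → ℝ :=
  Sum.elim s (fun _ => t)

/-- The variables `(y, s, s_gap, z)` of the path-following algorithm, together with the list
of all solver calls made so far. -/
structure PathState (n m : ℕ) where
  y : Fin n → ℝ
  s : Fin m → ℝ
  gap : ℝ
  z : ℝ
  calls : List (Query n)

/-- Replace `z` by `z'` and make one Newton step towards the analytic center of
`{(y, s, s_gap) : Aᵀ y + s = c, dᵀ y - s_gap = z', s ≥ 0, s_gap ≥ 0}`. -/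
noncomputable def moveTo {n m : ℕ} (solve : Solver n) (A : Matrix (Fin n) (Fin m) ℝ)
    (d : Fin n → ℝ) (c : Fin m → ℝ) (z' : ℝ) (st : PathState n m) : PathState n m :=
  let y' := newtonStep solve (extMat A d) (extVec c (-z')) st.y
  { y := y'
    s := c - Aᵀ *ᵥ y'
    gap := d ⬝ᵥ y' - z'
    z := z'
    calls := st.calls ++ [newtonQuery (extMat A d) (extVec c (-z')) st.y] }

/-- The procedure `Shift`. -/
noncomputable def shift {n m : ℕ} (solve : Solver n) (A : Matrix (Fin n) (Fin m) ℝ)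
    (b : Fin n → ℝ) (c : Fin m → ℝ) (st : PathState n m) : PathState n m :=
  moveTo solve A b c (st.z + st.gap / (10 * √(m : ℝ))) st

/-- The procedure `Unshift`, for the auxiliary objective `b'`. -/
noncomputable def unshift {n m : ℕ} (solve : Solver n) (A : Matrix (Fin n) (Fin m) ℝ)
    (b' : Fin n → ℝ) (c : Fin m → ℝ) (st : PathState n m) : PathState n m :=
  moveTo solve A b' c (st.z - st.gap / (10 * √(m : ℝ))) st

/-- `WhileRun guard body s t`: the loop `while guard do body`, started in the state `s`,
terminates in the state `t`. -/
inductive WhileRun {σ : Type} (guard : σ → Prop) (body : σ → σ) : σ → σ → Prop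
  | done (s : σ) : ¬ guard s → WhileRun guard body s s
  | loop (s t : σ) : guard s → WhileRun guard body (body s) t → WhileRun guard body s t

/-- The auxiliary objective `A (S⁰)⁻¹ 1`, where `s⁰ = c - Aᵀ y⁰`. -/
noncomputable def auxObj {n m : ℕ} (A : Matrix (Fin n) (Fin m) ℝ) (c : Fin m → ℝ)
    (y0 : Fin n → ℝ) : Fin n → ℝ :=
  A *ᵥ fun j => ((c - Aᵀ *ᵥ y0) j)⁻¹

/-- The initial state of `FindCentralPath`. -/
noncomputable def centralInit {n m : ℕ} (A : Matrix (Fin n) (Fin m) ℝ) (c : Fin m → ℝ)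
    (y0 : Fin n → ℝ) : PathState n m where
  y := y0
  s := c - Aᵀ *ᵥ y0
  gap := m
  z := auxObj A c y0 ⬝ᵥ y0 - m
  calls := []

/-- The threshold `40 λ_min^{-1/2} T m ‖d‖`. -/
noncomputable def gapBound {n : ℕ} (m : ℕ) (lam T : ℝ) (d : Fin n → ℝ) : ℝ :=
  40 * (√lam)⁻¹ * T * m * enorm2 d

/-- `FindCentralPath(A, b, c, y⁰)` terminates, and `st` is the resulting state. -/
def FindCentralPathRun {n m : ℕ} (solve : Solver n) (A : Matrix (Fin n) (Fin m) ℝ)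
    (b : Fin n → ℝ) (c : Fin m → ℝ) (lam T : ℝ) (y0 : Fin n → ℝ) (st : PathState n m) : Prop :=
  ∃ st' : PathState n m,
    WhileRun (fun r : PathState n m => r.gap < gapBound m lam T (auxObj A c y0))
      (unshift solve A (auxObj A c y0) c) (centralInit A c y0) st' ∧
    st = { y := st'.y
           s := st'.s
           gap := b ⬝ᵥ st'.y - (b ⬝ᵥ st'.y - gapBound m lam T b)
           z := b ⬝ᵥ st'.y - gapBound m lam T b
           calls := st'.calls }

/-- The largest absolute value of an entry of `A`, `b`, `c`. -/
noncomputable def maxEntry {n m : ℕ} (A : Matrix (Fin n) (Fin m) ℝ) (b : Fin n → ℝ)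
    (c : Fin m → ℝ) : ℝ :=
  max (⨆ p : Fin n × Fin m, |A p.1 p.2|) (max (⨆ i, |b i|) (⨆ j, |c j|))

/-- The last solver call of `InteriorPoint`. -/
noncomputable def finalQuery {n m : ℕ} (A : Matrix (Fin n) (Fin m) ℝ) (b : Fin n → ℝ)
    (c : Fin m → ℝ) (T : ℝ) (st : PathState n m) : Query n where
  mat := scaledGram (extMat A b) (extVec st.s st.gap)
  rhs := extMat A b *ᵥ fun k => (extVec st.s st.gap k)⁻¹
  acc := min 1 ((⨅ k, extVec st.s st.gap k) / (T * maxEntry A b c) * (√(m : ℝ) / n))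

/-- The vector `x = x' / (m x'_gap)` computed from the answer `v` to the last call, where
`x' = S⁻¹ 1 - S⁻² Aᵀ v` and `x'_gap = s_gap⁻¹ + s_gap⁻² bᵀ v`. -/
noncomputable def primalOutput {n m : ℕ} (A : Matrix (Fin n) (Fin m) ℝ) (b : Fin n → ℝ)
    (st : PathState n m) (v : Fin n → ℝ) : Fin m → ℝ :=
  fun j => ((st.s j)⁻¹ - (st.s j ^ 2)⁻¹ * (Aᵀ *ᵥ v) j) /
    (m * (st.gap⁻¹ + (st.gap ^ 2)⁻¹ * (b ⬝ᵥ v)))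

/-- `InteriorPoint(A, b, c, λ_min, T, y⁰, ε)`, using the solver `solve`, terminates with output
`x`; before its last solver call `q` it has made exactly the calls in the list `calls`. -/
def InteriorPointRun {n m : ℕ} (solve : Solver n) (A : Matrix (Fin n) (Fin m) ℝ)
    (b : Fin n → ℝ) (c : Fin m → ℝ) (lam T : ℝ) (y0 : Fin n → ℝ) (ε : ℝ)
    (x : Fin m → ℝ) (calls : List (Query n)) (q : Query n) : Prop :=
  ∃ st₁ st₂ : PathState n m,
    FindCentralPathRun solve A b c lam T y0 st₁ ∧
    WhileRun (fun r : PathState n m => ε / 3 < r.gap) (shift solve A b c) st₁ st₂ ∧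
    calls = st₂.calls ∧
    q = finalQuery A b c T st₂ ∧
    x = primalOutput A b st₂ (q.answer solve)

/-- The objective values of the primal program `min {cᵀ x : A x = b, x ≥ 0}`. -/
def primalValues {n m : ℕ} (A : Matrix (Fin n) (Fin m) ℝ) (b : Fin n → ℝ) (c : Fin m → ℝ) :
    Set ℝ :=
  {r | ∃ x : Fin m → ℝ, A *ᵥ x = b ∧ (∀ j, 0 ≤ x j) ∧ c ⬝ᵥ x = r}

/-- The objective values of the dual program `max {bᵀ y : Aᵀ y + s = c, s ≥ 0}`. -/
def dualValues {n m : ℕ} (A : Matrix (Fin n) (Fin m) ℝ) (b : Fin n → ℝ) (c : Fin m → ℝ) :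
    Set ℝ :=
  {r | ∃ (y : Fin n → ℝ) (s : Fin m → ℝ), Aᵀ *ᵥ y + s = c ∧ (∀ j, 0 ≤ s j) ∧ b ⬝ᵥ y = r}

/-- The smallest entry of the initial slack vector `s⁰ = c - Aᵀ y⁰`. -/
noncomputable def minSlack {n m : ℕ} (A : Matrix (Fin n) (Fin m) ℝ) (c : Fin m → ℝ)
    (y0 : Fin n → ℝ) : ℝ :=
  ⨅ j, (c - Aᵀ *ᵥ y0) j

/-- The condition number of the diagonal matrix with positive diagonal `s`. -/
noncomputable def diagCond {m : ℕ} (s : Fin m → ℝ) : ℝ := (⨆ j, s j) / (⨅ j, s j)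

end InteriorPt

/-!
The analysis follows the slacks `s` relative to a primal witness: `s` is `η`-central for a
constraint matrix `B` if some `x` with `B x = 0` satisfies `‖S x - 1‖ ≤ η` (`NearCentral`). The
exact relative Newton step `q` is the orthogonal projection of `1` onto the range of `S⁻¹ Bᵀ`, so
`‖q‖ ≤ η` and `S⁻¹ (1 - q)` is again a witness (`newtonProj_spec`). If the slacks are multiplied by
`1 + p`, this witness gives the error `(1 - q) (1 + p) - 1 = (p - q) - q p`, which is quadratically
small up to the inaccuracy of the solver (`newtonStep_spec`). A change of the gap by the factor
`1 ± 1 / (10 √m)` costs about `1 / 10` in centrality, which the next Newton step repairs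
(`OnPath.moveTo`). Hence all iterates of the first phase are `1 / 40`-central and those of the second
phase `1 / 12`-central; in between, the objective is exchanged by a minimum-norm correction of the
witness (`OnPath.change_objective`).

A witness is, up to scaling, a primal feasible point. By weak duality the distance from `z` to the
optimal value is therefore between the gap and `5 / 2` times the gap (`OnPath.gap_le`,
`OnPath.le_gap`). This distance grows in the first phase and shrinks in the second by a factor
`1 ± Ω(1 / √m)` per iteration, which gives termination and the number of calls
(`exists_centralPath_run`, `exists_shift_run`). Pairing the witness with the slacks of `y⁰` bounds
all slacks from below (`OnPath.le_slack`), hence the condition numbers and the norms of the rank-one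
parts (`Setting.call_form`). The output is the witness computed by an inexact projection, and its
residual is controlled by the accuracy of the last call (`primalOutput_spec`).

Strong duality follows by separating `(b, z*)` from the cone of pairs `(A x, t)` with `x ≥ 0` and
`t ≥ cᵀ x`, which is closed because `y⁰` is strictly feasible (`isLeast_primalValues`).
-/

namespace InteriorPt

/-! ### The Euclidean norm on coordinate vectors -/

section Norm

variable {κ : Type*} [Fintype κ]

/-- The Euclidean norm of a vector indexed by an arbitrary finite type. -/
noncomputable def l2norm (v : κ → ℝ) : ℝ := √(∑ k, v k ^ 2)

lemma enorm2_eq_l2norm {n : ℕ} (v : Fin n → ℝ) : enorm2 v = l2norm v := by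
  simp only [enorm2, l2norm, dotProduct, sq]

lemma l2norm_eq_norm (v : κ → ℝ) : l2norm v = ‖WithLp.toLp 2 v‖ := by
  simp [l2norm, EuclideanSpace.norm_eq]

lemma l2norm_nonneg (v : κ → ℝ) : 0 ≤ l2norm v := Real.sqrt_nonneg _

lemma l2norm_sq (v : κ → ℝ) : l2norm v ^ 2 = ∑ k, v k ^ 2 :=
  Real.sq_sqrt (Finset.sum_nonneg fun _ _ => sq_nonneg _)

lemma l2norm_sq_eq_dotProduct (v : κ → ℝ) : l2norm v ^ 2 = v ⬝ᵥ v := by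
  rw [l2norm_sq]
  simp only [dotProduct, sq]

lemma l2norm_le_iff {v : κ → ℝ} {r : ℝ} (hr : 0 ≤ r) : l2norm v ≤ r ↔ ∑ k, v k ^ 2 ≤ r ^ 2 :=
  Real.sqrt_le_left hr

lemma l2norm_add_le (v w : κ → ℝ) : l2norm (v + w) ≤ l2norm v + l2norm w := by
  simpa only [l2norm_eq_norm, WithLp.toLp_add] using norm_add_le _ _

lemma l2norm_sub_le (v w : κ → ℝ) : l2norm (v - w) ≤ l2norm v + l2norm w := by
  simpa only [l2norm_eq_norm, WithLp.toLp_sub] using norm_sub_le _ _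

lemma l2norm_smul (a : ℝ) (v : κ → ℝ) : l2norm (a • v) = |a| * l2norm v := by
  simp only [l2norm_eq_norm, WithLp.toLp_smul, norm_smul, Real.norm_eq_abs]

lemma l2norm_eq_zero {v : κ → ℝ} (h : l2norm v = 0) : v = 0 := by
  rw [l2norm_eq_norm, norm_eq_zero] at h
  simpa using h

lemma l2norm_pos {v : κ → ℝ} (h : v ≠ 0) : 0 < l2norm v :=
  lt_of_le_of_ne (l2norm_nonneg v) fun h' => h (l2norm_eq_zero h'.symm)

lemma l2norm_mono {v w : κ → ℝ} (h : ∀ k, |v k| ≤ |w k|) : l2norm v ≤ l2norm w :=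
  Real.sqrt_le_sqrt (Finset.sum_le_sum fun k _ => sq_le_sq.2 (h k))

lemma l2norm_const (a : ℝ) : l2norm (fun _ : κ => a) = √(Fintype.card κ) * |a| := by
  rw [l2norm, Finset.sum_const, nsmul_eq_mul, Real.sqrt_mul (Nat.cast_nonneg _),
    Real.sqrt_sq_eq_abs, Finset.card_univ]

lemma abs_le_l2norm (v : κ → ℝ) (k : κ) : |v k| ≤ l2norm v := by
  rw [← Real.sqrt_sq_eq_abs]
  exact Real.sqrt_le_sqrt
    (Finset.single_le_sum (f := fun k => v k ^ 2) (fun _ _ => sq_nonneg _) (Finset.mem_univ k))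

lemma abs_dotProduct_le (v w : κ → ℝ) : |v ⬝ᵥ w| ≤ l2norm v * l2norm w := by
  rw [l2norm, l2norm, ← Real.sqrt_mul (Finset.sum_nonneg fun _ _ => sq_nonneg _),
    ← Real.sqrt_sq_eq_abs]
  exact Real.sqrt_le_sqrt (Finset.sum_mul_sq_le_sq_mul_sq _ _ _)

lemma dotProduct_le (v w : κ → ℝ) : v ⬝ᵥ w ≤ l2norm v * l2norm w :=
  (le_abs_self _).trans (abs_dotProduct_le v w)

lemma l2norm_mul_le (v w : κ → ℝ) : l2norm (v * w) ≤ l2norm v * l2norm w := by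
  rw [l2norm_le_iff (mul_nonneg (l2norm_nonneg _) (l2norm_nonneg _)), mul_pow, l2norm_sq v,
    Finset.sum_mul]
  refine Finset.sum_le_sum fun k _ => ?_
  rw [Pi.mul_apply, mul_pow]
  refine mul_le_mul_of_nonneg_left ?_ (sq_nonneg _)
  exact sq_le_sq.2 ((abs_le_l2norm w k).trans (le_abs_self _))

lemma l2norm_le_of_abs_le {v : κ → ℝ} {r : ℝ} (hr : 0 ≤ r) (h : ∀ k, |v k| ≤ r) :
    l2norm v ≤ √(Fintype.card κ) * r := by
  rw [← abs_of_nonneg hr, ← l2norm_const]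
  exact l2norm_mono fun k => (h k).trans (le_abs_self r)

lemma l2norm_mulVec_le {n : ℕ} {B : Matrix (Fin n) κ ℝ} {u : ℝ} (hu : 0 ≤ u)
    (h : ∀ i k, |B i k| ≤ u) (v : κ → ℝ) :
    l2norm (B *ᵥ v) ≤ √n * (√(Fintype.card κ) * u * l2norm v) := by
  have := l2norm_le_of_abs_le (v := B *ᵥ v) (r := √(Fintype.card κ) * u * l2norm v)
    (by have := l2norm_nonneg v; positivity) fun i => by
      refine (abs_dotProduct_le (B i) v).trans ?_
      exact mul_le_mul_of_nonneg_right (l2norm_le_of_abs_le hu (h i)) (l2norm_nonneg v)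
  simpa using this

lemma dotProduct_mulVec_eq {n : ℕ} (B : Matrix (Fin n) κ ℝ) (x : κ → ℝ) (v : Fin n → ℝ) :
    v ⬝ᵥ B *ᵥ x = (Bᵀ *ᵥ v) ⬝ᵥ x := by
  rw [dotProduct_mulVec, mulVec_transpose]

end Norm

/-! ### Gram matrices and approximate projections -/

section Gram

variable {n : ℕ} {κ : Type} [Fintype κ] [DecidableEq κ]

lemma scaledGram_mulVec (B : Matrix (Fin n) κ ℝ) (s : κ → ℝ) (v : Fin n → ℝ) :
    scaledGram B s *ᵥ v = B *ᵥ (s⁻¹ * (s⁻¹ * (Bᵀ *ᵥ v))) := by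
  rw [scaledGram, ← mulVec_mulVec, ← mulVec_mulVec]
  congr 1
  ext k
  simp only [mulVec_diagonal, Pi.mul_apply, Pi.inv_apply]
  rw [sq, mul_inv, mul_assoc]

lemma dotProduct_scaledGram (B : Matrix (Fin n) κ ℝ) (s : κ → ℝ) (v : Fin n → ℝ) :
    v ⬝ᵥ scaledGram B s *ᵥ v = l2norm (s⁻¹ * (Bᵀ *ᵥ v)) ^ 2 := by
  rw [scaledGram_mulVec, dotProduct_mulVec_eq, l2norm_sq]
  simp only [dotProduct, Pi.mul_apply, Pi.inv_apply]
  exact Finset.sum_congr rfl fun k _ => by ring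

/-- The norm induced by `B S⁻² Bᵀ` is the Euclidean norm of `S⁻¹ Bᵀ v`. -/
lemma matNorm_scaledGram (B : Matrix (Fin n) κ ℝ) (s : κ → ℝ) (v : Fin n → ℝ) :
    matNorm (scaledGram B s) v = l2norm (s⁻¹ * (Bᵀ *ᵥ v)) := by
  rw [matNorm, dotProduct_scaledGram, Real.sqrt_sq (l2norm_nonneg _)]

lemma posDef_scaledGram {B : Matrix (Fin n) κ ℝ} (hB : ∀ v, Bᵀ *ᵥ v = 0 → v = 0) {s : κ → ℝ}
    (hs : ∀ k, 0 < s k) : (scaledGram B s).PosDef := by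
  refine PosDef.of_dotProduct_mulVec_pos ?_ fun v hv => ?_
  · simp only [scaledGram, IsHermitian, conjTranspose_eq_transpose_of_trivial, transpose_mul,
      transpose_transpose, diagonal_transpose, Matrix.mul_assoc]
  · rw [star_trivial, dotProduct_scaledGram]
    refine pow_pos (l2norm_pos fun h => hv (hB v ?_)) 2
    ext k
    have := congrFun h k
    simpa [(hs k).ne'] using this

/-- `s` is an `η`-approximate analytic center for the constraint matrix `B`: some `x` in the
kernel of `B` satisfies `‖S x - 1‖ ≤ η`. At the analytic center itself `x = S⁻¹ 1` works. -/
def NearCentral (B : Matrix (Fin n) κ ℝ) (s : κ → ℝ) (η : ℝ) : Prop :=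
  ∃ x, B *ᵥ x = 0 ∧ l2norm (s * x - 1) ≤ η

/-- The relative Newton step: the orthogonal projection of `1` onto the range of `S⁻¹ Bᵀ`, given
by the exact solution of the normal equations. Its complement `1 - q` lies in the kernel of
`B S⁻¹`, and its norm, the Newton decrement, is at most the distance of `1` from any other
element of that kernel. -/
lemma newtonProj_spec {B : Matrix (Fin n) κ ℝ} (hB : ∀ v, Bᵀ *ᵥ v = 0 → v = 0) {s : κ → ℝ}
    (hs : ∀ k, 0 < s k) {η : ℝ} (hc : NearCentral B s η) {q : κ → ℝ}
    (hq : q = s⁻¹ * (Bᵀ *ᵥ ((scaledGram B s)⁻¹ *ᵥ (B *ᵥ s⁻¹)))) :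
    B *ᵥ (s⁻¹ * (1 - q)) = 0 ∧ l2norm q ≤ η := by
  obtain ⟨x, hx, hxη⟩ := hc
  set w := (scaledGram B s)⁻¹ *ᵥ (B *ᵥ s⁻¹) with hw
  have hker : B *ᵥ (s⁻¹ * (1 - q)) = 0 := by
    have h1 : scaledGram B s *ᵥ w = B *ᵥ s⁻¹ := by
      rw [hw, mulVec_mulVec, mul_nonsing_inv _ ((isUnit_iff_isUnit_det _).1
        (posDef_scaledGram hB hs).isUnit), one_mulVec]
    rw [scaledGram_mulVec, ← hq] at h1
    rw [mul_sub, mul_one, mulVec_sub, h1, sub_self]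
  refine ⟨hker, ?_⟩
  -- `q` is orthogonal to the difference of the two elements of the kernel of `B S⁻¹`.
  have horth : q ⬝ᵥ (s * x - (1 - q)) = 0 := by
    have h2 : q ⬝ᵥ (s * x - (1 - q)) = (Bᵀ *ᵥ w) ⬝ᵥ (x - s⁻¹ * (1 - q)) := by
      rw [hq]
      simp only [dotProduct]
      refine Finset.sum_congr rfl fun k _ => ?_
      have := (hs k).ne'
      simp only [Pi.mul_apply, Pi.sub_apply, Pi.inv_apply, Pi.one_apply]
      field_simp
    rw [h2, ← dotProduct_mulVec_eq, mulVec_sub, hx, hker, sub_zero, dotProduct_zero]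
  have h3 : l2norm q ^ 2 ≤ l2norm q * l2norm (s * x - 1) := by
    have : l2norm q ^ 2 = -(q ⬝ᵥ (s * x - 1)) := by
      rw [l2norm_sq_eq_dotProduct]
      have : s * x - (1 - q) = (s * x - 1) + q := by ring
      rw [this, dotProduct_add] at horth
      linarith
    rw [this]
    exact (neg_le_abs _).trans (abs_dotProduct_le _ _)
  rcases (l2norm_nonneg q).eq_or_lt with h | h
  · rw [← h]; exact (l2norm_nonneg _).trans hxη
  · exact (le_of_mul_le_mul_left (by rwa [← sq]) h).trans hxη

/-- In the norm induced by the Gram matrix, an approximate solution of the normal equations is an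
approximate projection. -/
lemma approx_proj {B : Matrix (Fin n) κ ℝ} (hB : ∀ v, Bᵀ *ᵥ v = 0 → v = 0) {s : κ → ℝ}
    (hs : ∀ k, 0 < s k) {solve : Solver n} (hsolve : IsApproxSolver solve) {δ : ℝ} (hδ : 0 < δ)
    (r : Fin n → ℝ) :
    l2norm (s⁻¹ * (Bᵀ *ᵥ solve (scaledGram B s) r δ)
        - s⁻¹ * (Bᵀ *ᵥ ((scaledGram B s)⁻¹ *ᵥ r)))
      ≤ δ * l2norm (s⁻¹ * (Bᵀ *ᵥ ((scaledGram B s)⁻¹ *ᵥ r))) := by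
  have h := hsolve (scaledGram B s) r δ (posDef_scaledGram hB hs) hδ
  rwa [matNorm_scaledGram, matNorm_scaledGram, mulVec_sub, mul_sub] at h

/-- Quadratic convergence of the damped approximate Newton step. The slacks change by the factors
`1 + p`, and the witness for approximate centrality after the step is `S⁻¹ (1 - q)`, where `q` is
the exact relative step: `(1 - q) (1 + p) - 1 = (p - q) - q p`. -/
lemma newtonStep_spec {B : Matrix (Fin n) κ ℝ} (hB : ∀ v, Bᵀ *ᵥ v = 0 → v = 0)
    {solve : Solver n} (hsolve : IsApproxSolver solve) {g : κ → ℝ} {y : Fin n → ℝ} {s : κ → ℝ}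
    (hg : g - Bᵀ *ᵥ y = s) (hs : ∀ k, 0 < s k) {η : ℝ} (hc : NearCentral B s η) {δ : ℝ}
    (hδ : (newtonQuery B g y).acc = δ) (hδ0 : 0 < δ) (hδ1 : δ ≤ 1) :
    ∃ p : κ → ℝ, g - Bᵀ *ᵥ newtonStep solve B g y = s * (1 + p) ∧ l2norm p ≤ η ∧
      NearCentral B (s * (1 + p)) (2 * δ * η + η ^ 2) := by
  obtain ⟨hker, hqη⟩ := newtonProj_spec hB hs hc rfl
  set q := s⁻¹ * (Bᵀ *ᵥ ((scaledGram B s)⁻¹ *ᵥ (B *ᵥ s⁻¹))) with hq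
  have hη : 0 ≤ η := (l2norm_nonneg _).trans hqη
  set a := solve (scaledGram B s) (-(B *ᵥ s⁻¹)) δ with ha
  have hans : (newtonQuery B g y).answer solve = a := by
    rw [Query.answer, hδ, ha]
    simp only [newtonQuery, hg]
    rfl
  have happ := approx_proj hB hs hsolve hδ0 (-(B *ᵥ s⁻¹))
  rw [mulVec_neg, mulVec_neg, mul_neg, ← hq, ← ha] at happ
  have hnegq : l2norm (-q) = l2norm q := by
    have := l2norm_smul (-1) q
    simpa using this
  rw [hnegq] at happ
  set e := s⁻¹ * (Bᵀ *ᵥ a) - -q with he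
  -- the relative step is `q - e`, damped by `1 - δ`
  have hp : s⁻¹ * (Bᵀ *ᵥ a) = -(q - e) := by rw [he]; ring
  have heη : l2norm e ≤ δ * η := happ.trans (mul_le_mul_of_nonneg_left hqη hδ0.le)
  set p : κ → ℝ := (1 - δ) • (q - e) with hpdef
  have hδ' : |1 - δ| = 1 - δ := abs_of_nonneg (by linarith)
  have hqe : l2norm (q - e) ≤ (1 + δ) * η := by
    refine (l2norm_sub_le q e).trans ?_
    linarith
  have hpη : l2norm p ≤ η := by
    rw [hpdef, l2norm_smul, hδ']
    calc (1 - δ) * l2norm (q - e) ≤ (1 - δ) * ((1 + δ) * η) :=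
          mul_le_mul_of_nonneg_left hqe (by linarith)
      _ ≤ η := by nlinarith [mul_nonneg (sq_nonneg δ) hη]
  refine ⟨p, ?_, hpη, s⁻¹ * (1 - q), hker, ?_⟩
  · rw [newtonStep, hδ, hans, mulVec_add, mulVec_smul, ← sub_sub, hg]
    ext k
    have hk := congrFun hp k
    have := (hs k).ne'
    simp only [hpdef, Pi.mul_apply, Pi.inv_apply, Pi.neg_apply, Pi.sub_apply, Pi.smul_apply,
      smul_eq_mul, Pi.add_apply, Pi.one_apply] at hk ⊢
    have hk' : (Bᵀ *ᵥ a) k = -(s k * (q k - e k)) := by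
      field_simp at hk
      linarith
    rw [hk']; ring
  · have hdecomp : s * (1 + p) * (s⁻¹ * (1 - q)) - 1 = (p - q) - q * p := by
      ext k
      have := (hs k).ne'
      simp only [Pi.mul_apply, Pi.inv_apply, Pi.sub_apply, Pi.add_apply, Pi.one_apply]
      field_simp
      ring
    have hpq : p - q = -(δ • q) - (1 - δ) • e := by
      rw [hpdef, smul_sub, sub_smul, one_smul]; abel
    have h1 : l2norm (p - q) ≤ 2 * δ * η := by
      have h2 : -(δ • q) = (-δ) • q := by rw [neg_smul]
      rw [hpq, h2]
      refine (l2norm_sub_le _ _).trans ?_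
      rw [l2norm_smul, l2norm_smul, hδ', abs_neg, abs_of_pos hδ0]
      have h3 := mul_le_mul_of_nonneg_left hqη hδ0.le
      have h4 : (1 - δ) * l2norm e ≤ 1 * (δ * η) :=
        mul_le_mul (by linarith) heη (l2norm_nonneg _) zero_le_one
      linarith
    have h2 : l2norm (q * p) ≤ η ^ 2 := by
      rw [sq]
      exact (l2norm_mul_le q p).trans (mul_le_mul hqη hpη (l2norm_nonneg _) hη)
    rw [hdecomp]
    exact (l2norm_sub_le _ _).trans (add_le_add h1 h2)

end Gram

/-! ### Spectral bounds and the minimum-norm solution -/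

section Spectral

variable {n m : ℕ} {A : Matrix (Fin n) (Fin m) ℝ}

lemma dotProduct_gram (A : Matrix (Fin n) (Fin m) ℝ) (v : Fin n → ℝ) :
    v ⬝ᵥ (A * Aᵀ) *ᵥ v = l2norm (Aᵀ *ᵥ v) ^ 2 := by
  rw [← mulVec_mulVec, dotProduct_mulVec_eq, l2norm_sq_eq_dotProduct]

lemma transpose_mulVec_injective (hA : (A * Aᵀ).PosDef) (v : Fin n → ℝ) (hv : Aᵀ *ᵥ v = 0) :
    v = 0 := by
  by_contra h
  have := hA.dotProduct_mulVec_pos h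
  rw [star_trivial, dotProduct_gram, hv] at this
  simp [l2norm] at this

lemma card_le_of_posDef (hA : (A * Aᵀ).PosDef) : n ≤ m := by
  have h : Function.Injective (Aᵀ.mulVecLin) :=
    (injective_iff_map_eq_zero _).2 fun v hv => transpose_mulVec_injective hA v hv
  simpa using LinearMap.finrank_le_finrank_of_injective h

/-- A lower bound for the eigenvalues of a Hermitian matrix bounds its quadratic form. -/
lemma le_dotProduct_of_le_eigenvalues {M : Matrix (Fin n) (Fin n) ℝ} (hM : M.IsHermitian)
    {lam : ℝ} (h : ∀ i, lam ≤ hM.eigenvalues i) (v : Fin n → ℝ) :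
    lam * l2norm v ^ 2 ≤ v ⬝ᵥ M *ᵥ v := by
  have hH : (M - lam • (1 : Matrix (Fin n) (Fin n) ℝ)).IsHermitian :=
    hM.sub (by simp [IsHermitian])
  have hP : (M - lam • (1 : Matrix (Fin n) (Fin n) ℝ)).PosSemidef := by
    rw [hH.posSemidef_iff_eigenvalues_nonneg]
    intro i
    have hi := hH.eigenvalues_mem_spectrum_real i
    have h1 : hH.eigenvalues i + lam ∈ spectrum ℝ M := by
      rw [spectrum.mem_iff] at hi ⊢
      convert hi using 2
      rw [map_add, Algebra.algebraMap_eq_smul_one lam]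
      abel
    rw [hM.spectrum_real_eq_range_eigenvalues] at h1
    obtain ⟨j, hj⟩ := h1
    have := h j
    simp only [Pi.zero_apply]
    linarith
  have := hP.dotProduct_mulVec_nonneg v
  rw [star_trivial, sub_mulVec, dotProduct_sub, smul_mulVec, one_mulVec, dotProduct_smul,
    ← l2norm_sq_eq_dotProduct, smul_eq_mul] at this
  linarith

lemma sqrt_mul_l2norm_le (hA : (A * Aᵀ).PosDef) {lam : ℝ}
    (h : ∀ i, lam ≤ hA.isHermitian.eigenvalues i) (v : Fin n → ℝ) :
    √lam * l2norm v ≤ l2norm (Aᵀ *ᵥ v) := by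
  have h1 := le_dotProduct_of_le_eigenvalues hA.isHermitian h v
  rw [dotProduct_gram] at h1
  have h2 := Real.sqrt_le_sqrt h1
  rwa [Real.sqrt_mul' _ (sq_nonneg _), Real.sqrt_sq (l2norm_nonneg _),
    Real.sqrt_sq (l2norm_nonneg _)] at h2

/-- The solution `Aᵀ (A Aᵀ)⁻¹ r` of `A w = r` has norm at most `λ_min^{-1/2} ‖r‖`. -/
lemma exists_solution_l2norm_le (hA : (A * Aᵀ).PosDef) {lam : ℝ} (hlam : 0 < lam)
    (h : ∀ i, lam ≤ hA.isHermitian.eigenvalues i) (r : Fin n → ℝ) :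
    ∃ w, A *ᵥ w = r ∧ l2norm w ≤ (√lam)⁻¹ * l2norm r := by
  set u := (A * Aᵀ)⁻¹ *ᵥ r with hu
  have h1 : A *ᵥ (Aᵀ *ᵥ u) = r := by
    rw [mulVec_mulVec, hu, mulVec_mulVec,
      mul_nonsing_inv _ ((isUnit_iff_isUnit_det _).1 hA.isUnit), one_mulVec]
  refine ⟨Aᵀ *ᵥ u, h1, ?_⟩
  have h2 : l2norm (Aᵀ *ᵥ u) ^ 2 ≤ l2norm u * l2norm r := by
    rw [← dotProduct_gram, ← mulVec_mulVec, h1]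
    exact dotProduct_le u r
  have h3 := sqrt_mul_l2norm_le hA h u
  have hl : 0 < √lam := Real.sqrt_pos.2 hlam
  rw [← div_eq_inv_mul, le_div_iff₀ hl]
  rcases (l2norm_nonneg (Aᵀ *ᵥ u)).eq_or_lt with h4 | h4
  · rw [← h4, zero_mul]; exact l2norm_nonneg r
  · refine le_of_mul_le_mul_left ?_ h4
    calc l2norm (Aᵀ *ᵥ u) * (l2norm (Aᵀ *ᵥ u) * √lam) = √lam * l2norm (Aᵀ *ᵥ u) ^ 2 := by ring
      _ ≤ √lam * (l2norm u * l2norm r) := mul_le_mul_of_nonneg_left h2 hl.le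
      _ = √lam * l2norm u * l2norm r := by ring
      _ ≤ _ := mul_le_mul_of_nonneg_right h3 (l2norm_nonneg r)

end Spectral

/-! ### Linear programming duality -/

section Duality

variable {n m : ℕ} {A : Matrix (Fin n) (Fin m) ℝ} {c : Fin m → ℝ} {T : ℝ} {y0 : Fin n → ℝ}

/-- The polytope `{y : Aᵀ y ≤ c}` is bounded by `T` in the sup norm, both in `y` and in the slacks
`c - Aᵀ y`. -/
def DualBounded (A : Matrix (Fin n) (Fin m) ℝ) (c : Fin m → ℝ) (T : ℝ) : Prop :=
  ∀ (y : Fin n → ℝ) (s : Fin m → ℝ), s = c - Aᵀ *ᵥ y → (∀ j, 0 ≤ s j) →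
    (∀ i, |y i| ≤ T) ∧ ∀ j, |s j| ≤ T

/-- A bounded polytope `{y : Aᵀ y ≤ c}` has no recession direction. -/
lemma recession_eq_zero (hT : DualBounded A c T) (hy0 : ∀ j, (Aᵀ *ᵥ y0) j < c j)
    {w : Fin n → ℝ} (hw : ∀ j, (Aᵀ *ᵥ w) j ≤ 0) : w = 0 := by
  by_contra hne
  obtain ⟨i, hi⟩ := Function.ne_iff.1 hne
  simp only [Pi.zero_apply] at hi
  have hi' : 0 < |w i| := abs_pos.2 hi
  set t : ℝ := (|T| + |y0 i| + 1) / |w i| with ht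
  have ht0 : 0 ≤ t := by positivity
  have h := (hT (y0 + t • w) _ rfl fun j => by
    have h1 := mul_nonpos_of_nonneg_of_nonpos ht0 (hw j)
    have h2 := hy0 j
    simp only [mulVec_add, mulVec_smul, Pi.sub_apply, Pi.add_apply, Pi.smul_apply, smul_eq_mul]
    linarith).1 i
  simp only [Pi.add_apply, Pi.smul_apply, smul_eq_mul] at h
  have h1 : |t * w i| = |T| + |y0 i| + 1 := by
    rw [abs_mul, abs_of_nonneg ht0, ht, div_mul_cancel₀ _ hi'.ne']
  have h2 : |t * w i| ≤ |y0 i + t * w i| + |y0 i| := by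
    have := abs_sub (y0 i + t * w i) (y0 i)
    simpa using this
  linarith [le_abs_self T]

/-- A bounded polytope with an interior point is cut out by at least two inequalities. -/
lemma two_le_of_dualBounded (hn : 0 < n) (hA : (A * Aᵀ).PosDef) (hT : DualBounded A c T)
    (hy0 : ∀ j, (Aᵀ *ᵥ y0) j < c j) : 2 ≤ m := by
  by_contra hm
  have hnm := card_le_of_posDef hA
  have hm1 : m = 1 := by omega
  subst hm1
  set w : Fin n → ℝ := Pi.single ⟨0, hn⟩ 1 with hw
  have hwne : w ≠ 0 := by simp [hw]
  rcases le_total ((Aᵀ *ᵥ w) 0) 0 with h | h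
  · exact hwne (recession_eq_zero hT hy0 fun j => by rwa [Subsingleton.elim j 0])
  · refine hwne (neg_eq_zero.1 (recession_eq_zero hT hy0 (w := -w) fun j => ?_))
    rw [Subsingleton.elim j 0, mulVec_neg, Pi.neg_apply]
    linarith

/-- The maximum of any linear functional over the bounded dual polytope is attained. -/
lemma exists_isGreatest_dualValues (hT : DualBounded A c T) (hy0 : ∀ j, (Aᵀ *ᵥ y0) j < c j)
    (d : Fin n → ℝ) : ∃ z, IsGreatest (dualValues A d c) z := by
  set P : Set (Fin n → ℝ) := {y | ∀ j, (Aᵀ *ᵥ y) j ≤ c j} with hP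
  have hclosed : IsClosed P := by
    rw [hP, Set.ofPred_forall]
    refine isClosed_iInter fun j => isClosed_le ?_ continuous_const
    exact (continuous_apply j).comp (Continuous.matrix_mulVec continuous_const continuous_id)
  have hsub : P ⊆ Set.Icc (fun _ => -T) (fun _ => T) := by
    intro y hy
    have h := (hT y _ rfl fun j => by simpa using hy j).1
    exact ⟨fun i => (abs_le.1 (h i)).1, fun i => (abs_le.1 (h i)).2⟩
  have hcomp : IsCompact P := isCompact_Icc.of_isClosed_subset hclosed hsub
  obtain ⟨y, hy, hmax⟩ := hcomp.exists_isMaxOn ⟨y0, fun j => (hy0 j).le⟩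
    (f := fun y => d ⬝ᵥ y) (Continuous.dotProduct continuous_const continuous_id).continuousOn
  refine ⟨d ⬝ᵥ y, ⟨y, c - Aᵀ *ᵥ y, by abel, fun j => by simpa using hy j, rfl⟩, ?_⟩
  rintro _ ⟨y', s', h1, h2, rfl⟩
  refine hmax fun j => ?_
  have := h2 j
  rw [← h1]
  simpa using this

/-- The cone of attainable right-hand sides and cost upper bounds of the primal program. -/
def primalCone (A : Matrix (Fin n) (Fin m) ℝ) (c : Fin m → ℝ) : Set ((Fin n → ℝ) × ℝ) :=
  {p | ∃ x : Fin m → ℝ, (∀ j, 0 ≤ x j) ∧ A *ᵥ x = p.1 ∧ c ⬝ᵥ x ≤ p.2}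

lemma convex_primalCone (A : Matrix (Fin n) (Fin m) ℝ) (c : Fin m → ℝ) :
    Convex ℝ (primalCone A c) := by
  rintro ⟨p1, p2⟩ ⟨x, hx, h1, h2⟩ ⟨q1, q2⟩ ⟨x', hx', h1', h2'⟩ a a' ha ha' -
  refine ⟨a • x + a' • x', fun j => ?_, ?_, ?_⟩
  · have := mul_nonneg ha (hx j)
    have := mul_nonneg ha' (hx' j)
    simp only [Pi.add_apply, Pi.smul_apply, smul_eq_mul]
    linarith
  · simp only [mulVec_add, mulVec_smul, h1, h1']
    rfl
  · simp only [dotProduct_add, dotProduct_smul, smul_eq_mul, Prod.smul_mk, Prod.mk_add_mk]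
    exact add_le_add (mul_le_mul_of_nonneg_left h2 ha) (mul_le_mul_of_nonneg_left h2' ha')

/-- The cone is closed: a strictly feasible dual point `y⁰` turns a bound on `(A x, cᵀ x)` into a
bound on `s⁰ᵀ x = cᵀ x - y⁰ᵀ A x`, hence on `x ≥ 0`. -/
lemma isClosed_primalCone (hy0 : ∀ j, (Aᵀ *ᵥ y0) j < c j) : IsClosed (primalCone A c) := by
  refine IsSeqClosed.isClosed fun p p0 hp hlim => ?_
  choose x hx0 hxA hxc using hp
  have hlim1 : Filter.Tendsto (fun k => (p k).1) Filter.atTop (nhds p0.1) :=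
    (continuous_fst.tendsto p0).comp hlim
  have hlim2 : Filter.Tendsto (fun k => (p k).2) Filter.atTop (nhds p0.2) :=
    (continuous_snd.tendsto p0).comp hlim
  have hcont : Filter.Tendsto (fun k => (p k).2 - y0 ⬝ᵥ (p k).1) Filter.atTop
      (nhds (p0.2 - y0 ⬝ᵥ p0.1)) :=
    hlim2.sub (((Continuous.dotProduct continuous_const continuous_id).tendsto p0.1).comp hlim1)
  obtain ⟨R, hR⟩ := hcont.bddAbove_range
  have hbound : ∀ k j, x k j ≤ R / (c j - (Aᵀ *ᵥ y0) j) := by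
    intro k j
    rw [le_div_iff₀ (sub_pos.2 (hy0 j))]
    have h1 : (c - Aᵀ *ᵥ y0) ⬝ᵥ x k ≤ R := by
      refine le_trans ?_ (hR ⟨k, rfl⟩)
      simp only
      rw [sub_dotProduct, ← dotProduct_mulVec_eq, hxA]
      linarith [hxc k]
    refine le_trans ?_ h1
    rw [mul_comm]
    exact Finset.single_le_sum (f := fun j => (c - Aᵀ *ᵥ y0) j * x k j)
      (fun i _ => mul_nonneg (by simpa using (hy0 i).le) (hx0 k i)) (Finset.mem_univ j)
  obtain ⟨x', hx'mem, φ, hφ, hφlim⟩ :=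
    (isCompact_Icc (a := (0 : Fin m → ℝ)) (b := fun j => R / (c j - (Aᵀ *ᵥ y0) j))).tendsto_subseq
      (x := x) fun k => ⟨hx0 k, hbound k⟩
  refine ⟨x', hx'mem.1, ?_, ?_⟩
  · refine tendsto_nhds_unique ?_ (hlim1.comp hφ.tendsto_atTop)
    have := ((Continuous.matrix_mulVec continuous_const continuous_id).tendsto x'
      : Filter.Tendsto (fun x => A *ᵥ x) _ _).comp hφlim
    refine this.congr fun k => ?_
    exact hxA (φ k)
  · refine le_of_tendsto_of_tendsto
      (((Continuous.dotProduct continuous_const continuous_id).tendsto x'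
        : Filter.Tendsto (fun x => c ⬝ᵥ x) _ _).comp hφlim) (hlim2.comp hφ.tendsto_atTop) ?_
    exact Filter.Eventually.of_forall fun k => hxc (φ k)

lemma weak_duality {b : Fin n → ℝ} {z r : ℝ} (hz : z ∈ dualValues A b c)
    (hr : r ∈ primalValues A b c) : z ≤ r := by
  obtain ⟨y, s, hs, hs0, rfl⟩ := hz
  obtain ⟨x, hx, hx0, rfl⟩ := hr
  rw [← hs, ← hx, dotProduct_comm, dotProduct_mulVec_eq, add_dotProduct]
  have : 0 ≤ s ⬝ᵥ x := Finset.sum_nonneg fun j _ => mul_nonneg (hs0 j) (hx0 j)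
  linarith

/-- Strong duality: if the dual polytope is bounded and has an interior point, the dual optimum is
also the attained primal optimum. Otherwise `(b, z*)` could be separated from the closed primal
cone, and the separating functional would give either a dual point of larger value or a recession
direction of the dual polytope. -/
lemma isLeast_primalValues (hT : DualBounded A c T) (hy0 : ∀ j, (Aᵀ *ᵥ y0) j < c j)
    {b : Fin n → ℝ} {z : ℝ} (hz : IsGreatest (dualValues A b c) z) :
    IsLeast (primalValues A b c) z := by
  have hmem : (b, z) ∈ primalCone A c := by
    by_contra hnot
    obtain ⟨f, u, hfu, huf⟩ := geometric_hahn_banach_point_closed (convex_primalCone A c)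
      (isClosed_primalCone hy0) hnot
    -- the functional in coordinates
    set w : Fin n → ℝ := fun i => f (Pi.single i 1, 0) with hw
    set τ : ℝ := f (0, 1) with hτ
    have hf : ∀ (p : Fin n → ℝ) (t : ℝ), f (p, t) = w ⬝ᵥ p + τ * t := by
      intro p t
      have h1 : (p, t) = ∑ i, p i • ((Pi.single i 1, 0) : (Fin n → ℝ) × ℝ) + t • (0, 1) := by
        ext
        · simp [Prod.fst_sum, Finset.sum_apply, Pi.single_apply]
        · simp [Prod.snd_sum]
      rw [h1, map_add, map_sum, map_smul]
      simp only [map_smul, smul_eq_mul, dotProduct, hw, hτ]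
      congr 1
      · exact Finset.sum_congr rfl fun i _ => mul_comm _ _
      · ring
    have hu0 : u < 0 := by
      have := huf (0, 0) ⟨0, fun _ => le_rfl, by simp, by simp⟩
      simpa [hf] using this
    -- on a cone, a functional bounded below is nonnegative
    have hcone : ∀ (x : Fin m → ℝ) (t : ℝ), (∀ j, 0 ≤ x j) → 0 ≤ t →
        0 ≤ w ⬝ᵥ A *ᵥ x + τ * (c ⬝ᵥ x + t) := by
      intro x t hx ht
      by_contra hneg
      push Not at hneg
      set v := w ⬝ᵥ A *ᵥ x + τ * (c ⬝ᵥ x + t) with hv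
      have h0 : 0 ≤ u / v := div_nonneg_of_nonpos hu0.le hneg.le
      have := huf (A *ᵥ ((u / v) • x), c ⬝ᵥ ((u / v) • x) + (u / v) * t)
        ⟨(u / v) • x, fun j => mul_nonneg h0 (hx j), rfl, by
          have := mul_nonneg h0 ht
          simp only
          linarith⟩
      rw [hf, mulVec_smul, dotProduct_smul, dotProduct_smul] at this
      have h2 : (u / v) • (w ⬝ᵥ A *ᵥ x) + τ * ((u / v) • (c ⬝ᵥ x) + u / v * t) = u / v * v := by
        rw [hv, smul_eq_mul, smul_eq_mul]; ring
      rw [h2, div_mul_cancel₀ _ hneg.ne] at this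
      exact lt_irrefl _ this
    have hτ0 : 0 ≤ τ := by
      have := hcone 0 1 (fun _ => le_rfl) zero_le_one
      simpa using this
    have hslack : ∀ j, 0 ≤ (Aᵀ *ᵥ w) j + τ * c j := by
      intro j
      have := hcone (Pi.single j 1) 0 (fun i => by
        by_cases h : i = j
        · subst h; simp
        · simp [h]) le_rfl
      rw [dotProduct_mulVec_eq] at this
      simpa using this
    have hval : w ⬝ᵥ b + τ * z < 0 := by
      rw [← hf]; exact hfu.trans hu0
    rcases hτ0.eq_or_lt with h0 | hpos
    · have hw0 : -w = 0 := recession_eq_zero hT hy0 fun j => by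
        have := hslack j
        rw [mulVec_neg, Pi.neg_apply]
        rw [← h0] at this
        linarith
      rw [neg_eq_zero.1 hw0, ← h0] at hval
      simp at hval
    · have := hz.2 ⟨-(τ⁻¹ • w), c - Aᵀ *ᵥ (-(τ⁻¹ • w)), by abel, fun j => by
        have := mul_nonneg (inv_pos.2 hpos).le (hslack j)
        rw [mul_add, ← mul_assoc, inv_mul_cancel₀ hpos.ne'] at this
        simp only [mulVec_neg, mulVec_smul, Pi.sub_apply, Pi.neg_apply, Pi.smul_apply, smul_eq_mul]
        linarith, rfl⟩
      rw [dotProduct_neg, dotProduct_smul, smul_eq_mul, dotProduct_comm] at this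
      have h1 : τ * (-(τ⁻¹ * (w ⬝ᵥ b))) ≤ τ * z := mul_le_mul_of_nonneg_left this hpos.le
      have h2 : τ * (-(τ⁻¹ * (w ⬝ᵥ b))) = -(w ⬝ᵥ b) := by field_simp
      linarith
  obtain ⟨x, hx0, hxA, hxc⟩ := hmem
  simp only at hxA hxc
  have hx : c ⬝ᵥ x ∈ primalValues A b c := ⟨x, hxA, hx0, rfl⟩
  have hzx : c ⬝ᵥ x = z := le_antisymm hxc (weak_duality hz.1 hx)
  exact ⟨hzx ▸ hx, fun r hr => weak_duality hz.1 hr⟩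

end Duality

/-! ### The extended constraint system -/

section Extended

variable {n m : ℕ} {A : Matrix (Fin n) (Fin m) ℝ} {c : Fin m → ℝ} {d : Fin n → ℝ}

lemma extMat_mulVec (A : Matrix (Fin n) (Fin m) ℝ) (d : Fin n → ℝ) (x : Fin m ⊕ Fin m → ℝ) :
    extMat A d *ᵥ x = A *ᵥ (x ∘ Sum.inl) - (∑ j, x (Sum.inr j)) • d := by
  ext i
  simp only [extMat, mulVec, dotProduct, Fintype.sum_sum_type, fromCols_apply_inl,
    fromCols_apply_inr, of_apply, Pi.sub_apply, Pi.smul_apply, smul_eq_mul, Function.comp,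
    Finset.sum_mul, sub_eq_add_neg, ← Finset.sum_neg_distrib]
  congr 1
  exact Finset.sum_congr rfl fun j _ => by ring

lemma extMat_transpose_mulVec (A : Matrix (Fin n) (Fin m) ℝ) (d v : Fin n → ℝ) :
    (extMat A d)ᵀ *ᵥ v = extVec (Aᵀ *ᵥ v) (-(d ⬝ᵥ v)) := by
  ext k
  cases k <;>
    simp [extMat, extVec, mulVec, dotProduct, Matrix.transpose_apply, Finset.sum_neg_distrib]

lemma extMat_transpose_injective (hA : ∀ v, Aᵀ *ᵥ v = 0 → v = 0) (d v : Fin n → ℝ)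
    (h : (extMat A d)ᵀ *ᵥ v = 0) : v = 0 := by
  refine hA v ?_
  ext j
  have := congrFun h (Sum.inl j)
  rwa [extMat_transpose_mulVec] at this

lemma extVec_slack (A : Matrix (Fin n) (Fin m) ℝ) (c : Fin m → ℝ) (d y : Fin n → ℝ) (z : ℝ) :
    extVec c (-z) - (extMat A d)ᵀ *ᵥ y = extVec (c - Aᵀ *ᵥ y) (d ⬝ᵥ y - z) := by
  rw [extMat_transpose_mulVec]
  ext k
  cases k
  · simp [extVec]
  · simp [extVec]; ring

lemma extVec_pos {s : Fin m → ℝ} {t : ℝ} (hs : ∀ j, 0 < s j) (ht : 0 < t)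
    (k : Fin m ⊕ Fin m) : 0 < extVec s t k := by
  cases k
  · exact hs _
  · exact ht

lemma l2norm_extVec_zero (t : ℝ) : l2norm (extVec (0 : Fin m → ℝ) t) = √m * |t| := by
  rw [← Real.sqrt_sq_eq_abs, ← Real.sqrt_mul (Nat.cast_nonneg _), l2norm]
  simp [extVec]

lemma scaledGram_apply {κ : Type} [Fintype κ] [DecidableEq κ] (B : Matrix (Fin n) κ ℝ) (s : κ → ℝ)
    (i k : Fin n) : scaledGram B s i k = ∑ j, B i j * (s j ^ 2)⁻¹ * B k j := by
  rw [scaledGram, mul_apply]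
  simp only [mul_diagonal, transpose_apply]

/-- The `m` copies of the column `-d` contribute the rank-one term `v vᵀ`, `v = (√m / t) d`. -/
lemma scaledGram_extMat (A : Matrix (Fin n) (Fin m) ℝ) (d : Fin n → ℝ) (s : Fin m → ℝ) (t : ℝ) :
    scaledGram (extMat A d) (extVec s t)
      = scaledGram A s + vecMulVec ((√m / t) • d) ((√m / t) • d) := by
  ext i k
  rw [Matrix.add_apply, scaledGram_apply, scaledGram_apply]
  simp only [extMat, extVec, Fintype.sum_sum_type,
    fromCols_apply_inl, fromCols_apply_inr, of_apply, Sum.elim_inl, Sum.elim_inr, vecMulVec_apply,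
    Pi.smul_apply, smul_eq_mul, Finset.sum_const, Finset.card_univ, Fintype.card_fin, nsmul_eq_mul]
  congr 1
  have h : √(m : ℝ) * √m = m := Real.mul_self_sqrt (Nat.cast_nonneg m)
  calc (m : ℝ) * (-d i * (t ^ 2)⁻¹ * -d k) = (√m * √m) * (-d i * (t ^ 2)⁻¹ * -d k) := by rw [h]
    _ = _ := by rw [div_eq_mul_inv, sq, mul_inv]; ring

lemma NearCentral.mono {κ : Type} [Fintype κ] [DecidableEq κ] {B : Matrix (Fin n) κ ℝ}
    {s : κ → ℝ} {η η' : ℝ} (h : NearCentral B s η) (hη : η ≤ η') : NearCentral B s η' := by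
  obtain ⟨x, hx, hxη⟩ := h
  exact ⟨x, hx, hxη.trans hη⟩

/-- Rescaling the gap by `1 + θ` with `|θ| ≤ 1 / (10 √m)` costs `(1 + h) / 10` in centrality. -/
lemma NearCentral.scale_gap (hm : 0 < m) {s : Fin m → ℝ} {t h θ : ℝ}
    (hc : NearCentral (extMat A d) (extVec s t) h) (hθ : |θ| ≤ 1 / (10 * √(m : ℝ))) :
    NearCentral (extMat A d) (extVec s (t * (1 + θ))) (h + (1 + h) / 10) := by
  obtain ⟨x, hx, hxh⟩ := hc
  refine ⟨x, hx, ?_⟩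
  have hdec : extVec s (t * (1 + θ)) * x - 1
      = (extVec s t * x - 1) + (extVec 0 θ + extVec 0 θ * (extVec s t * x - 1)) := by
    ext k
    cases k
    · simp [extVec]
    · simp [extVec]; ring
  have hm' : 0 < √(m : ℝ) := Real.sqrt_pos.2 (Nat.cast_pos.2 hm)
  have h1 : l2norm (extVec (0 : Fin m → ℝ) θ) ≤ 1 / 10 := by
    rw [l2norm_extVec_zero]
    calc √(m : ℝ) * |θ| ≤ √m * (1 / (10 * √(m : ℝ))) := mul_le_mul_of_nonneg_left hθ hm'.le
      _ = 1 / 10 := by field_simp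
  rw [hdec]
  refine (l2norm_add_le _ _).trans (add_le_add hxh ((l2norm_add_le _ _).trans ?_))
  have h2 := (l2norm_mul_le (extVec 0 θ) (extVec s t * x - 1)).trans
    (mul_le_mul h1 hxh (l2norm_nonneg _) (by norm_num))
  linarith

/-- A near-central point carries an almost feasible primal point: `A x = X d` with `x ≈ S⁻¹ 1`
and `X ≈ m / t`. -/
lemma NearCentral.exists_primal {s : Fin m → ℝ} {t h : ℝ}
    (hc : NearCentral (extMat A d) (extVec s t) h) :
    ∃ (x : Fin m → ℝ) (X : ℝ), A *ᵥ x = X • d ∧ (∀ j, 1 - h ≤ s j * x j ∧ s j * x j ≤ 1 + h) ∧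
      m * (1 - h) ≤ t * X ∧ t * X ≤ m * (1 + h) := by
  obtain ⟨x, hx, hxh⟩ := hc
  have hk : ∀ k, |extVec s t k * x k - 1| ≤ h := fun k => (abs_le_l2norm _ k).trans hxh
  refine ⟨x ∘ Sum.inl, ∑ j, x (Sum.inr j), ?_, fun j => ?_, ?_, ?_⟩
  · rw [extMat_mulVec] at hx
    exact sub_eq_zero.1 hx
  · have := abs_le.1 (hk (Sum.inl j))
    simp only [extVec, Sum.elim_inl] at this
    exact ⟨by simp only [Function.comp]; linarith [this.1],
      by simp only [Function.comp]; linarith [this.2]⟩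
  · have : ∑ _j : Fin m, (1 - h) ≤ ∑ j, t * x (Sum.inr j) := Finset.sum_le_sum fun j _ => by
      have := (abs_le.1 (hk (Sum.inr j))).1
      simp only [extVec, Sum.elim_inr] at this
      linarith
    rw [Finset.mul_sum]
    simpa only [Finset.sum_const, Finset.card_univ, Fintype.card_fin, nsmul_eq_mul] using this
  · have : ∑ j, t * x (Sum.inr j) ≤ ∑ _j : Fin m, (1 + h) := Finset.sum_le_sum fun j _ => by
      have := (abs_le.1 (hk (Sum.inr j))).2
      simp only [extVec, Sum.elim_inr] at this
      linarith
    rw [Finset.mul_sum]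
    simpa only [Finset.sum_const, Finset.card_univ, Fintype.card_fin, nsmul_eq_mul] using this

end Extended

/-! ### States near the central path -/

section Path

variable {n m : ℕ} {A : Matrix (Fin n) (Fin m) ℝ} {c : Fin m → ℝ} {d : Fin n → ℝ} {h : ℝ}
  {st : PathState n m}

/-- The invariant of the path-following loops: the slacks and the gap belong to `y` and `z`, are
positive, and form an `h`-approximate analytic center. -/
structure OnPath (A : Matrix (Fin n) (Fin m) ℝ) (d : Fin n → ℝ) (c : Fin m → ℝ) (h : ℝ)
    (st : PathState n m) : Prop where
  slack : st.s = c - Aᵀ *ᵥ st.y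
  gap_eq : st.gap = d ⬝ᵥ st.y - st.z
  slack_pos : ∀ j, 0 < st.s j
  gap_pos : 0 < st.gap
  central : NearCentral (extMat A d) (extVec st.s st.gap) h

lemma OnPath.slack_bounds {T : ℝ} (H : OnPath A d c h st) (hT : DualBounded A c T) :
    (∀ i, |st.y i| ≤ T) ∧ ∀ j, st.s j ≤ T := by
  have := hT st.y st.s H.slack fun j => (H.slack_pos j).le
  exact ⟨this.1, fun j => (le_abs_self _).trans (this.2 j)⟩

lemma OnPath.mem_dualValues (H : OnPath A d c h st) : d ⬝ᵥ st.y ∈ dualValues A d c :=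
  ⟨st.y, st.s, by rw [H.slack]; abel, fun j => (H.slack_pos j).le, rfl⟩

lemma OnPath.gap_le {zs : ℝ} (H : OnPath A d c h st) (hz : IsGreatest (dualValues A d c) zs) :
    st.gap ≤ zs - st.z := by
  have := hz.2 H.mem_dualValues
  rw [H.gap_eq]
  linarith

/-- Near the central path the gap is comparable with the distance of `z` to the optimal value. -/
lemma OnPath.le_gap {zs : ℝ} (H : OnPath A d c h st) (h12 : h ≤ 1 / 12) (hm : 0 < m)
    (hz : IsGreatest (dualValues A d c) zs) : zs - st.z ≤ 5 / 2 * st.gap := by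
  obtain ⟨x, X, hx, hsx, hX1, -⟩ := H.central.exists_primal
  obtain ⟨y', s', hs', hs'0, rfl⟩ := hz.1
  have hm' : (0 : ℝ) < m := Nat.cast_pos.2 hm
  have hg := H.gap_pos
  have hX : 0 < X := by
    by_contra hX
    have h1 := mul_nonpos_of_nonneg_of_nonpos hg.le (not_lt.1 hX)
    have h2 : 0 < (m : ℝ) * (1 - h) := mul_pos hm' (by linarith)
    linarith
  have hx0 : ∀ j, 0 ≤ x j := fun j => by
    have h1 : 0 < st.s j * x j := by linarith [(hsx j).1]
    exact (pos_of_mul_pos_right h1 (H.slack_pos j).le).le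
  -- weak duality for the primal point `x / X`
  have hsum : st.s ⬝ᵥ x ≤ m * (1 + h) := by
    have : ∑ j, st.s j * x j ≤ ∑ _j : Fin m, (1 + h) := Finset.sum_le_sum fun j _ => (hsx j).2
    simpa only [dotProduct, Finset.sum_const, Finset.card_univ, Fintype.card_fin,
      nsmul_eq_mul] using this
  have hdot : ∀ v : Fin n → ℝ, (Aᵀ *ᵥ v) ⬝ᵥ x = X * (d ⬝ᵥ v) := fun v => by
    rw [← dotProduct_mulVec_eq, hx, dotProduct_smul, smul_eq_mul, dotProduct_comm]
  have h1 : X * (d ⬝ᵥ y') ≤ X * (d ⬝ᵥ st.y) + m * (1 + h) := by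
    have e1 : c ⬝ᵥ x = X * (d ⬝ᵥ y') + s' ⬝ᵥ x := by rw [← hs', add_dotProduct, hdot]
    have e2 : c ⬝ᵥ x = X * (d ⬝ᵥ st.y) + st.s ⬝ᵥ x := by
      rw [H.slack, sub_dotProduct, hdot]; ring
    have : 0 ≤ s' ⬝ᵥ x := Finset.sum_nonneg fun j _ => mul_nonneg (hs'0 j) (hx0 j)
    linarith
  have h2 : (m : ℝ) * (1 + h) ≤ 3 / 2 * (st.gap * X) := by
    have : (m : ℝ) * (1 + h) ≤ 3 / 2 * (m * (1 - h)) := by nlinarith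
    linarith
  have h3 : X * (d ⬝ᵥ y' - d ⬝ᵥ st.y) ≤ X * (3 / 2 * st.gap) := by linarith
  have h4 := le_of_mul_le_mul_left h3 hX
  linarith [H.gap_eq]

/-- A slack near the central path cannot be much smaller than the slack of a strictly feasible
point `y0`, unless `y0` lies far below the level of the current point. -/
lemma OnPath.le_slack {y0 : Fin n → ℝ} {ρ : ℝ} (H : OnPath A d c h st) (h12 : h ≤ 1 / 12)
    (hy0 : ∀ j, (Aᵀ *ᵥ y0) j < c j) (hρ : 0 ≤ ρ) (hd : d ⬝ᵥ st.y - d ⬝ᵥ y0 ≤ ρ * st.gap)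
    (j : Fin m) : (c - Aᵀ *ᵥ y0) j ≤ 2 * m * (1 + ρ) * st.s j := by
  obtain ⟨x, X, hx, hsx, hX1, hX2⟩ := H.central.exists_primal
  have hx0 : ∀ j, 0 ≤ x j := fun j => by
    have h1 : 0 < st.s j * x j := by linarith [(hsx j).1]
    exact (pos_of_mul_pos_right h1 (H.slack_pos j).le).le
  have hm' : (0 : ℝ) ≤ m := Nat.cast_nonneg m
  have hX : 0 ≤ X := by
    have h2 : 0 ≤ (m : ℝ) * (1 - h) := mul_nonneg hm' (by linarith)
    exact nonneg_of_mul_nonneg_right (h2.trans hX1) H.gap_pos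
  have hsum : st.s ⬝ᵥ x ≤ m * (1 + h) := by
    have : ∑ j, st.s j * x j ≤ ∑ _j : Fin m, (1 + h) := Finset.sum_le_sum fun j _ => (hsx j).2
    simpa only [dotProduct, Finset.sum_const, Finset.card_univ, Fintype.card_fin,
      nsmul_eq_mul] using this
  have hdot : ∀ v : Fin n → ℝ, (Aᵀ *ᵥ v) ⬝ᵥ x = X * (d ⬝ᵥ v) := fun v => by
    rw [← dotProduct_mulVec_eq, hx, dotProduct_smul, smul_eq_mul, dotProduct_comm]
  have h1 : (c - Aᵀ *ᵥ y0) ⬝ᵥ x = st.s ⬝ᵥ x + X * (d ⬝ᵥ st.y - d ⬝ᵥ y0) := by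
    rw [H.slack, sub_dotProduct, sub_dotProduct, hdot, hdot]; ring
  have h2 : X * (d ⬝ᵥ st.y - d ⬝ᵥ y0) ≤ m * (1 + h) * ρ :=
    calc X * (d ⬝ᵥ st.y - d ⬝ᵥ y0) ≤ X * (ρ * st.gap) := mul_le_mul_of_nonneg_left hd hX
      _ = st.gap * X * ρ := by ring
      _ ≤ _ := mul_le_mul_of_nonneg_right hX2 hρ
  have h3 : (c - Aᵀ *ᵥ y0) j * x j ≤ m * (1 + ρ) * (1 + h) := by
    have : (c - Aᵀ *ᵥ y0) j * x j ≤ (c - Aᵀ *ᵥ y0) ⬝ᵥ x :=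
      Finset.single_le_sum (f := fun j => (c - Aᵀ *ᵥ y0) j * x j)
        (fun i _ => mul_nonneg (by simpa using (hy0 i).le) (hx0 i)) (Finset.mem_univ j)
    linarith
  have h0 : 0 ≤ (c - Aᵀ *ᵥ y0) j := by simpa using (hy0 j).le
  have h4 : (c - Aᵀ *ᵥ y0) j * (1 - h) ≤ (m * (1 + ρ) * (1 + h)) * st.s j :=
    calc (c - Aᵀ *ᵥ y0) j * (1 - h) ≤ (c - Aᵀ *ᵥ y0) j * (st.s j * x j) :=
          mul_le_mul_of_nonneg_left (hsx j).1 h0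
      _ = ((c - Aᵀ *ᵥ y0) j * x j) * st.s j := by ring
      _ ≤ _ := mul_le_mul_of_nonneg_right h3 (H.slack_pos j).le
  have h5 : 0 ≤ m * (1 + ρ) * st.s j := by have := (H.slack_pos j).le; positivity
  nlinarith

lemma acc_eq (A : Matrix (Fin n) (Fin m) ℝ) (d : Fin n → ℝ) (g : Fin m ⊕ Fin m → ℝ)
    (y : Fin n → ℝ) : (newtonQuery (extMat A d) g y).acc = 1 / (20 * (√(2 * m : ℝ) + 1)) := by
  simp [newtonQuery, two_mul]

lemma newton_acc_le (hm : 0 < m) : 1 / (20 * (√(2 * m : ℝ) + 1)) ≤ 1 / 40 := by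
  have : (1 : ℝ) ≤ √(2 * m : ℝ) := by
    rw [Real.one_le_sqrt]
    have : (1 : ℝ) ≤ m := Nat.one_le_cast.2 hm
    linarith
  exact one_div_le_one_div_of_le (by norm_num) (by linarith)

/-- One move of the path-following method: rescaling the gap by `1 + θ` and taking one Newton step
keeps the iterate near the central path. In the condition on `h'`, `h + (1 + h) / 10` is the
centrality after rescaling, and `1 / 20` bounds twice the accuracy requested from the solver. Both
`h = h' = 1 / 40` and `h = h' = 1 / 12` satisfy it. -/
lemma OnPath.moveTo (hm : 0 < m) (hA : ∀ v, Aᵀ *ᵥ v = 0 → v = 0) {solve : Solver n}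
    (hsolve : IsApproxSolver solve) (H : OnPath A d c h st) (h12 : h ≤ 1 / 12) {θ z' : ℝ}
    (hθ : |θ| ≤ 1 / (10 * √(m : ℝ))) (hz' : d ⬝ᵥ st.y - z' = st.gap * (1 + θ)) {h' : ℝ}
    (hh' : 1 / 20 * (h + (1 + h) / 10) + (h + (1 + h) / 10) ^ 2 ≤ h') :
    OnPath A d c h' (moveTo solve A d c z' st) ∧
      3 / 4 * (st.gap * (1 + θ)) ≤ (InteriorPt.moveTo solve A d c z' st).gap := by
  set η := h + (1 + h) / 10 with hη
  have hθ' : |θ| ≤ 1 / 10 := by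
    refine hθ.trans (one_div_le_one_div_of_le (by norm_num) ?_)
    have : (1 : ℝ) ≤ √(m : ℝ) := Real.one_le_sqrt.2 (Nat.one_le_cast.2 hm)
    linarith
  have hθ1 : 0 < 1 + θ := by linarith [(abs_le.1 hθ').1]
  have hcen := H.central.scale_gap hm hθ
  have hpos : ∀ k, 0 < extVec st.s (st.gap * (1 + θ)) k :=
    extVec_pos H.slack_pos (mul_pos H.gap_pos hθ1)
  have hg : extVec c (-z') - (extMat A d)ᵀ *ᵥ st.y = extVec st.s (st.gap * (1 + θ)) := by
    rw [extVec_slack, hz', H.slack]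
  obtain ⟨p, hp1, hp2, hp3⟩ := newtonStep_spec (extMat_transpose_injective hA d) hsolve hg hpos
    hcen (acc_eq A d _ _) (by positivity) ((newton_acc_le hm).trans (by norm_num))
  have hη1 : η ≤ 1 / 4 := by rw [hη]; linarith
  have hη0 : 0 ≤ η := (l2norm_nonneg _).trans hp2
  have hp : ∀ k, 3 / 4 ≤ 1 + p k := fun k => by
    have := (abs_le.1 ((abs_le_l2norm p k).trans hp2)).1
    linarith
  set y' := newtonStep solve (extMat A d) (extVec c (-z')) st.y with hy'
  rw [extVec_slack] at hp1
  have hs : ∀ j, (c - Aᵀ *ᵥ y') j = st.s j * (1 + p (Sum.inl j)) := fun j => by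
    have := congrFun hp1 (Sum.inl j)
    simpa [extVec] using this
  have hgap : d ⬝ᵥ y' - z' = st.gap * (1 + θ) * (1 + p (Sum.inr ⟨0, hm⟩)) := by
    have := congrFun hp1 (Sum.inr ⟨0, hm⟩)
    simpa [extVec] using this
  have hgp := mul_pos H.gap_pos hθ1
  refine ⟨⟨rfl, rfl, fun j => ?_, ?_, ?_⟩, ?_⟩
  · change 0 < (c - Aᵀ *ᵥ y') j
    rw [hs]
    exact mul_pos (H.slack_pos j) (by linarith [hp (Sum.inl j)])
  · change 0 < d ⬝ᵥ y' - z'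
    rw [hgap]
    exact mul_pos hgp (by linarith [hp (Sum.inr ⟨0, hm⟩)])
  · change NearCentral (extMat A d) (extVec (c - Aᵀ *ᵥ y') (d ⬝ᵥ y' - z')) h'
    rw [hp1]
    refine hp3.mono (le_trans ?_ hh')
    have := mul_le_mul_of_nonneg_right (newton_acc_le hm) hη0
    rw [← hη]
    linarith
  · change 3 / 4 * (st.gap * (1 + θ)) ≤ d ⬝ᵥ y' - z'
    rw [hgap]
    have := mul_le_mul_of_nonneg_left (hp (Sum.inr ⟨0, hm⟩)) hgp.le
    linarith

/-- The first phase starts exactly at the analytic center for the auxiliary objective. -/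
lemma onPath_centralInit (hm : 0 < m) {y0 : Fin n → ℝ} (hy0 : ∀ j, (Aᵀ *ᵥ y0) j < c j) :
    OnPath A (auxObj A c y0) c (1 / 40) (centralInit A c y0) := by
  have hm' : (0 : ℝ) < m := Nat.cast_pos.2 hm
  refine ⟨rfl, by simp [centralInit], fun j => by simpa [centralInit] using hy0 j, hm',
    extVec (fun j => ((c - Aᵀ *ᵥ y0) j)⁻¹) (m : ℝ)⁻¹, ?_, ?_⟩
  · have h1 : extVec (fun j => ((c - Aᵀ *ᵥ y0) j)⁻¹) (m : ℝ)⁻¹ ∘ Sum.inl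
        = fun j => ((c - Aᵀ *ᵥ y0) j)⁻¹ := rfl
    have h2 : ∑ j : Fin m, extVec (fun j => ((c - Aᵀ *ᵥ y0) j)⁻¹) (m : ℝ)⁻¹ (Sum.inr j) = 1 := by
      simp [extVec, hm'.ne']
    rw [extMat_mulVec, h1, h2, one_smul, auxObj, sub_self]
  · have : extVec (centralInit A c y0).s (centralInit A c y0).gap
        * extVec (fun j => ((c - Aᵀ *ᵥ y0) j)⁻¹) (m : ℝ)⁻¹ - 1 = 0 := by
      ext k
      cases k with
      | inl j =>
        have := (sub_pos.2 (hy0 j)).ne'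
        simp [extVec, centralInit, this]
      | inr j => simp [extVec, centralInit, hm'.ne']
    rw [this]
    simp [l2norm]

/-- Once the auxiliary gap is large, the objective can be exchanged: correcting the primal witness
by the minimum-norm solution of `A w = (m / g) b - X d` restores feasibility at the cost of a small
loss of centrality. -/
lemma OnPath.change_objective (hm : 0 < m) (hA : (A * Aᵀ).PosDef) {lam T : ℝ} (hlam : 0 < lam)
    (hev : ∀ i, lam ≤ hA.isHermitian.eigenvalues i) (hT1 : 1 ≤ T) (hT : DualBounded A c T)
    {b : Fin n → ℝ} (hb : b ≠ 0) (H : OnPath A d c (1 / 40) st)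
    (hgap : gapBound m lam T d ≤ st.gap) :
    NearCentral (extMat A b) (extVec st.s (gapBound m lam T b)) (1 / 12) := by
  have hm' : (0 : ℝ) < m := Nat.cast_pos.2 hm
  have hl : 0 < √lam := Real.sqrt_pos.2 hlam
  have hT0 : 0 < T := by linarith
  obtain ⟨x, hx, hxh⟩ := H.central
  rw [extMat_mulVec, sub_eq_zero] at hx
  set X := ∑ j, x (Sum.inr j) with hXdef
  have hbn := l2norm_pos hb
  set g := gapBound m lam T b with hg
  have hgeq : g = 40 * (√lam)⁻¹ * T * m * l2norm b := by
    rw [hg, gapBound, enorm2_eq_l2norm]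
  have hg0 : 0 < g := by rw [hgeq]; positivity
  obtain ⟨w, hw, hwn⟩ := exists_solution_l2norm_le hA hlam hev ((m / g) • b - X • d)
  have hX : |X| * st.gap ≤ m * (1 + 1 / 40) := by
    rw [← abs_of_pos H.gap_pos, ← abs_mul, hXdef, Finset.sum_mul]
    refine (Finset.abs_sum_le_sum_abs _ _).trans ?_
    have : ∑ j : Fin m, |x (Sum.inr j) * st.gap| ≤ ∑ _j : Fin m, (1 + 1 / 40 : ℝ) := by
      refine Finset.sum_le_sum fun j _ => ?_
      have := abs_le.1 ((abs_le_l2norm _ (Sum.inr j)).trans hxh)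
      simp only [extVec, Pi.sub_apply, Pi.mul_apply, Sum.elim_inr, Pi.one_apply] at this
      rw [abs_le]
      constructor <;> linarith [this.1, this.2]
    simpa only [Finset.sum_const, Finset.card_univ, Fintype.card_fin, nsmul_eq_mul] using this
  -- both terms of the right-hand side are of order `√lam / T`
  have hr1 : l2norm ((m / g) • b) = √lam / (40 * T) := by
    rw [l2norm_smul, abs_of_pos (by positivity), hgeq]
    field_simp
  have hr2 : l2norm (X • d) ≤ (1 + 1 / 40) * (√lam / (40 * T)) := by
    rw [l2norm_smul]
    have h1 : m * l2norm d ≤ st.gap * (√lam / (40 * T)) := by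
      rw [gapBound, enorm2_eq_l2norm] at hgap
      calc m * l2norm d = 40 * (√lam)⁻¹ * T * m * l2norm d * (√lam / (40 * T)) := by field_simp
        _ ≤ _ := mul_le_mul_of_nonneg_right hgap (by positivity)
    have h2 : |X| * (m * l2norm d) ≤ m * ((1 + 1 / 40) * (√lam / (40 * T))) :=
      calc |X| * (m * l2norm d) ≤ |X| * (st.gap * (√lam / (40 * T))) :=
            mul_le_mul_of_nonneg_left h1 (abs_nonneg _)
        _ = |X| * st.gap * (√lam / (40 * T)) := by ring
        _ ≤ m * (1 + 1 / 40) * (√lam / (40 * T)) := mul_le_mul_of_nonneg_right hX (by positivity)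
        _ = _ := by ring
    refine le_of_mul_le_mul_left ?_ hm'
    linarith
  have hwT : T * l2norm w ≤ (2 + 1 / 40) / 40 := by
    have h1 : l2norm w ≤ (√lam)⁻¹ * ((2 + 1 / 40) * (√lam / (40 * T))) := by
      refine hwn.trans (mul_le_mul_of_nonneg_left ?_ (inv_pos.2 hl).le)
      refine (l2norm_sub_le _ _).trans ?_
      rw [hr1]
      linarith
    calc T * l2norm w ≤ T * ((√lam)⁻¹ * ((2 + 1 / 40) * (√lam / (40 * T)))) :=
          mul_le_mul_of_nonneg_left h1 hT0.le
      _ = _ := by field_simp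
  refine ⟨Sum.elim (x ∘ Sum.inl + w) (fun _ => g⁻¹), ?_, ?_⟩
  · have h1 : (Sum.elim (x ∘ Sum.inl + w) (fun _ : Fin m => g⁻¹)) ∘ Sum.inl
        = x ∘ Sum.inl + w := rfl
    have h2 : ∑ j : Fin m, Sum.elim (x ∘ Sum.inl + w) (fun _ : Fin m => g⁻¹) (Sum.inr j)
        = m / g := by
      simp [div_eq_mul_inv]
    rw [extMat_mulVec, h1, h2, mulVec_add, hx, hw]
    abel
  · have hdec : extVec st.s g * Sum.elim (x ∘ Sum.inl + w) (fun _ : Fin m => g⁻¹) - 1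
        = Sum.elim (fun j => st.s j * x (Sum.inl j) - 1) (fun _ => 0)
          + Sum.elim (fun j => st.s j * w j) (fun _ => 0) := by
      ext k
      cases k
      · simp [extVec]; ring
      · simp [extVec, hg0.ne']
    have h1 : l2norm (Sum.elim (fun j => st.s j * x (Sum.inl j) - 1) (fun _ : Fin m => (0 : ℝ)))
        ≤ 1 / 40 := by
      refine (l2norm_mono fun k => ?_).trans hxh
      cases k
      · simp [extVec]
      · simp
    have h2 : l2norm (Sum.elim (fun j => st.s j * w j) (fun _ : Fin m => (0 : ℝ)))
        ≤ T * l2norm w := by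
      have h3 : l2norm (Sum.elim (fun j => st.s j * w j) (fun _ : Fin m => (0 : ℝ)))
          = l2norm (fun j => st.s j * w j) := by
        simp [l2norm]
      rw [h3, ← abs_of_pos hT0, ← l2norm_smul]
      refine l2norm_mono fun j => ?_
      have := (H.slack_bounds hT).2 j
      simp only [Pi.smul_apply, smul_eq_mul, abs_mul, abs_of_pos hT0, abs_of_pos (H.slack_pos j)]
      exact mul_le_mul_of_nonneg_right this (abs_nonneg _)
    rw [hdec]
    refine (l2norm_add_le _ _).trans ((add_le_add h1 (h2.trans hwT)).trans ?_)
    norm_num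

end Path

/-! ### Loops -/

section Loops

lemma exists_whileRun {σ : Type} {guard : σ → Prop} {body : σ → σ} (N : ℕ) (s : σ)
    (hN : ¬ guard (body^[N] s)) :
    ∃ k ≤ N, WhileRun guard body s (body^[k] s) ∧ ¬ guard (body^[k] s) ∧
      ∀ i < k, guard (body^[i] s) := by
  induction N generalizing s with
  | zero => exact ⟨0, le_rfl, .done s hN, hN, fun i hi => absurd hi (Nat.not_lt_zero i)⟩
  | succ N ih =>
    by_cases hs : guard s
    · obtain ⟨k, hk, hrun, hnot, hall⟩ := ih (body s) hN
      refine ⟨k + 1, Nat.succ_le_succ hk, .loop _ _ hs hrun, hnot, fun i hi => ?_⟩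
      cases i with
      | zero => exact hs
      | succ i => exact hall i (Nat.lt_of_succ_lt_succ hi)
    · exact ⟨0, Nat.zero_le _, .done s hs, hs, fun i hi => absurd hi (Nat.not_lt_zero i)⟩

lemma iterate_calls {n m : ℕ} {body : PathState n m → PathState n m}
    {Q : PathState n m → Query n} (hbody : ∀ st, (body st).calls = st.calls ++ [Q st])
    (k : ℕ) (st : PathState n m) :
    (body^[k] st).calls.length = st.calls.length + k ∧
      ∀ p ∈ (body^[k] st).calls, p ∈ st.calls ∨ ∃ i < k, p = Q (body^[i] st) := by
  induction k with
  | zero => exact ⟨rfl, fun p hp => Or.inl hp⟩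
  | succ k ih =>
    rw [Function.iterate_succ_apply', hbody]
    refine ⟨by rw [List.length_append, ih.1, List.length_singleton, Nat.add_assoc], fun p hp => ?_⟩
    rcases List.mem_append.1 hp with hp | hp
    · rcases ih.2 p hp with h | ⟨i, hi, h⟩
      · exact Or.inl h
      · exact Or.inr ⟨i, hi.trans (Nat.lt_succ_self k), h⟩
    · exact Or.inr ⟨k, Nat.lt_succ_self k, List.mem_singleton.1 hp⟩

lemma le_exp_of_contraction {a : ℕ → ℝ} {r : ℝ} (h0 : ∀ i, 0 ≤ a i)
    (h : ∀ i, a (i + 1) ≤ a i * (1 - r)) (N : ℕ) : a N ≤ a 0 * Real.exp (-(r * N)) := by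
  induction N with
  | zero => simp
  | succ N ih =>
    have h1 : 1 - r ≤ Real.exp (-r) := by
      have := Real.add_one_le_exp (-r)
      linarith
    calc a (N + 1) ≤ a N * (1 - r) := h N
      _ ≤ a N * Real.exp (-r) := mul_le_mul_of_nonneg_left h1 (h0 N)
      _ ≤ a 0 * Real.exp (-(r * N)) * Real.exp (-r) :=
          mul_le_mul_of_nonneg_right ih (Real.exp_pos _).le
      _ = a 0 * Real.exp (-(r * (N + 1 : ℕ))) := by
          rw [mul_assoc, ← Real.exp_add]; push_cast; ring_nf

end Loops

/-! ### The two phases -/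

section Phases

variable {n m : ℕ} {A : Matrix (Fin n) (Fin m) ℝ} {c : Fin m → ℝ} {d : Fin n → ℝ} {T : ℝ}
  {y0 : Fin n → ℝ} {solve : Solver n} {st : PathState n m} {h : ℝ}

lemma newtonQuery_mat (H : OnPath A d c h st) (z' : ℝ) :
    (newtonQuery (extMat A d) (extVec c (-z')) st.y).mat
      = scaledGram (extMat A d) (extVec st.s (d ⬝ᵥ st.y - z')) := by
  simp only [newtonQuery]
  rw [extVec_slack, H.slack]

lemma inv_ten_sqrt_pos (hm : 0 < m) : 0 < 1 / (10 * √(m : ℝ)) := by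
  have : 0 < √(m : ℝ) := Real.sqrt_pos.2 (Nat.cast_pos.2 hm)
  positivity

lemma inv_ten_sqrt_le (hm : 0 < m) : 1 / (10 * √(m : ℝ)) ≤ 1 / 10 := by
  have : (1 : ℝ) ≤ √(m : ℝ) := Real.one_le_sqrt.2 (Nat.one_le_cast.2 hm)
  exact one_div_le_one_div_of_le (by norm_num) (by linarith)

lemma OnPath.shift (hm : 0 < m) (hA : ∀ v, Aᵀ *ᵥ v = 0 → v = 0) (hsolve : IsApproxSolver solve)
    (H : OnPath A d c (1 / 12) st) :
    OnPath A d c (1 / 12) (shift solve A d c st) ∧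
      2 / 3 * st.gap ≤ (InteriorPt.shift solve A d c st).gap := by
  have h1 := inv_ten_sqrt_pos hm
  have h2 := inv_ten_sqrt_le hm
  obtain ⟨h3, h4⟩ := H.moveTo hm hA hsolve le_rfl (θ := -(1 / (10 * √(m : ℝ))))
    (z' := st.z + st.gap / (10 * √(m : ℝ))) (h' := 1 / 12)
    (by rw [abs_neg, abs_of_pos h1]) (by rw [H.gap_eq]; ring) (by norm_num)
  refine ⟨h3, le_trans ?_ h4⟩
  have := mul_le_mul_of_nonneg_left h2 H.gap_pos.le
  linarith [H.gap_pos]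

lemma OnPath.unshift (hm : 0 < m) (hA : ∀ v, Aᵀ *ᵥ v = 0 → v = 0)
    (hsolve : IsApproxSolver solve) (H : OnPath A d c (1 / 40) st) :
    OnPath A d c (1 / 40) (unshift solve A d c st) := by
  have h1 := inv_ten_sqrt_pos hm
  exact (H.moveTo hm hA hsolve (by norm_num) (θ := 1 / (10 * √(m : ℝ)))
    (z' := st.z - st.gap / (10 * √(m : ℝ))) (h' := 1 / 40)
    (by rw [abs_of_pos h1]) (by rw [H.gap_eq]; ring) (by norm_num)).1

/-- The first phase: the distance of `z` to the optimal auxiliary value grows by a factor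
`1 + 1 / (25 √m)` in each iteration, and the gap grows with it. -/
lemma exists_centralPath_run (hm : 0 < m) (hA : ∀ v, Aᵀ *ᵥ v = 0 → v = 0)
    (hsolve : IsApproxSolver solve) (hT : DualBounded A c T)
    (hy0 : ∀ j, (Aᵀ *ᵥ y0) j < c j) (hd : d = auxObj A c y0) {Γ Λ : ℝ} (hΛ : 0 ≤ Λ)
    (hΓ : Γ ≤ 2 / 5 * (m * Real.exp Λ)) :
    ∃ st : PathState n m,
      WhileRun (fun r : PathState n m => r.gap < Γ) (unshift solve A d c)
        (centralInit A c y0) st ∧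
      OnPath A d c (1 / 40) st ∧ Γ ≤ st.gap ∧ (st.calls.length : ℝ) ≤ 50 * √(m : ℝ) * Λ + 1 ∧
      ∀ p ∈ st.calls, p.acc = 1 / (20 * (√(2 * m : ℝ) + 1)) ∧
        ∃ (st' : PathState n m) (t : ℝ), OnPath A d c (1 / 40) st' ∧
          d ⬝ᵥ st'.y - d ⬝ᵥ y0 ≤ st'.gap ∧ 2 / 5 * m ≤ st'.gap ∧ st'.gap ≤ t ∧
          p.mat = scaledGram (extMat A d) (extVec st'.s t) := by
  have hm' : (0 : ℝ) < m := Nat.cast_pos.2 hm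
  have hsm : (1 : ℝ) ≤ √(m : ℝ) := Real.one_le_sqrt.2 (Nat.one_le_cast.2 hm)
  obtain ⟨zs, hz⟩ := exists_isGreatest_dualValues hT hy0 d
  set S : ℕ → PathState n m := fun i => (InteriorPt.unshift solve A d c)^[i] (centralInit A c y0)
    with hS
  have hSsucc : ∀ i, S (i + 1) = InteriorPt.unshift solve A d c (S i) := fun i => by
    simp only [hS, Function.iterate_succ_apply']
  have hon : ∀ i, OnPath A d c (1 / 40) (S i) := by
    intro i
    induction i with
    | zero => rw [hd]; exact onPath_centralInit hm hy0
    | succ i ih => rw [hSsucc]; exact ih.unshift hm hA hsolve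
  have hzsucc : ∀ i, (S (i + 1)).z = (S i).z - (S i).gap / (10 * √(m : ℝ)) := fun i => by
    rw [hSsucc]; rfl
  have hz0 : ∀ i, (S i).z ≤ d ⬝ᵥ y0 - m := by
    intro i
    induction i with
    | zero => rw [hd]; exact le_rfl
    | succ i ih =>
      rw [hzsucc]
      have : 0 ≤ (S i).gap / (10 * √(m : ℝ)) := div_nonneg (hon i).gap_pos.le (by positivity)
      linarith
  have hD0 : ∀ i, (m : ℝ) ≤ zs - (S i).z := fun i => by
    have h1 := hz.2 (show d ⬝ᵥ y0 ∈ dualValues A d c from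
      ⟨y0, c - Aᵀ *ᵥ y0, by abel, fun j => by simpa using (hy0 j).le, rfl⟩)
    linarith [hz0 i]
  have hDgap : ∀ i, zs - (S i).z ≤ 5 / 2 * (S i).gap := fun i =>
    (hon i).le_gap (by norm_num) hm hz
  -- the reciprocal of the distance is a contracting sequence: `1 / (1 + 2 t) ≤ 1 - t` for small `t`
  have hDgrow : ∀ i, (zs - (S (i + 1)).z)⁻¹ ≤ (zs - (S i).z)⁻¹ * (1 - 1 / (50 * √(m : ℝ))) := by
    intro i
    have hDi : 0 < zs - (S i).z := hm'.trans_le (hD0 i)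
    have h1 : (zs - (S i).z) * (1 + 1 / (25 * √(m : ℝ))) ≤ zs - (S (i + 1)).z := by
      have h2 : (zs - (S i).z) * (1 / (25 * √(m : ℝ))) ≤ (S i).gap / (10 * √(m : ℝ)) :=
        calc (zs - (S i).z) * (1 / (25 * √(m : ℝ)))
            ≤ 5 / 2 * (S i).gap * (1 / (25 * √(m : ℝ))) :=
              mul_le_mul_of_nonneg_right (hDgap i) (by positivity)
          _ = (S i).gap / (10 * √(m : ℝ)) := by field_simp; ring
      rw [hzsucc]
      linarith
    have h3 : 0 < 1 + 1 / (25 * √(m : ℝ)) := by positivity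
    refine (inv_anti₀ (mul_pos hDi h3) h1).trans ?_
    rw [mul_inv]
    refine mul_le_mul_of_nonneg_left ?_ (inv_pos.2 hDi).le
    rw [inv_le_iff_one_le_mul₀ h3]
    set t : ℝ := 1 / (50 * √(m : ℝ)) with ht
    have ht' : 1 / (25 * √(m : ℝ)) = 2 * t := by rw [ht]; field_simp; norm_num
    have ht0 : 0 ≤ t := by positivity
    have ht1 : t ≤ 1 / 50 := one_div_le_one_div_of_le (by norm_num) (by linarith)
    rw [ht']
    nlinarith
  have hexp := le_exp_of_contraction (a := fun i => (zs - (S i).z)⁻¹)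
    (fun i => (inv_pos.2 (hm'.trans_le (hD0 i))).le) hDgrow
  set N := ⌈50 * √(m : ℝ) * Λ⌉₊ with hN
  have hNge : 50 * √(m : ℝ) * Λ ≤ N := Nat.le_ceil _
  have hNlt : (N : ℝ) < 50 * √(m : ℝ) * Λ + 1 := Nat.ceil_lt_add_one (by positivity)
  have hexit : ¬ (S N).gap < Γ := by
    rw [not_lt]
    have h1 : (zs - (S N).z)⁻¹ ≤ (m : ℝ)⁻¹ * Real.exp (-Λ) := by
      refine (hexp N).trans (mul_le_mul ?_ ?_ (Real.exp_pos _).le (inv_pos.2 hm').le)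
      · exact inv_anti₀ hm' (hD0 0)
      · refine Real.exp_le_exp.2 (neg_le_neg ?_)
        calc Λ = 1 / (50 * √(m : ℝ)) * (50 * √(m : ℝ) * Λ) := by field_simp
          _ ≤ _ := mul_le_mul_of_nonneg_left hNge (by positivity)
    rw [Real.exp_neg, ← mul_inv] at h1
    have h2 := (inv_le_inv₀ (hm'.trans_le (hD0 N)) (mul_pos hm' (Real.exp_pos Λ))).1 h1
    linarith [hDgap N]
  obtain ⟨k, hkN, hrun, hnot, -⟩ := exists_whileRun (guard := fun r : PathState n m => r.gap < Γ)
    (body := InteriorPt.unshift solve A d c) N (centralInit A c y0) hexit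
  obtain ⟨hlen, hcalls⟩ := iterate_calls (body := InteriorPt.unshift solve A d c)
    (Q := fun st => newtonQuery (extMat A d) (extVec c (-(st.z - st.gap / (10 * √(m : ℝ))))) st.y)
    (fun _ => rfl) k (centralInit A c y0)
  refine ⟨S k, hrun, hon k, not_lt.1 hnot, ?_, fun p hp => ?_⟩
  · simp only [hS]
    rw [hlen]
    have : (k : ℝ) ≤ N := Nat.cast_le.2 hkN
    simp only [centralInit, List.length_nil, Nat.zero_add]
    linarith
  · rcases hcalls p hp with h | ⟨i, -, rfl⟩
    · simp [centralInit] at h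
    · refine ⟨acc_eq A d _ _, S i, _, hon i, ?_, ?_, ?_, newtonQuery_mat (hon i) _⟩
      · linarith [(hon i).gap_eq, hz0 i]
      · linarith [hD0 i, hDgap i]
      · have : 0 ≤ (S i).gap / (10 * √(m : ℝ)) := div_nonneg (hon i).gap_pos.le (by positivity)
        change _ ≤ d ⬝ᵥ (S i).y - ((S i).z - (S i).gap / (10 * √(m : ℝ)))
        linarith [(hon i).gap_eq]

/-- The second phase: the distance of `z` to the optimal value shrinks by a factor
`1 - 1 / (25 √m)` in each iteration, and it bounds the gap. -/
lemma exists_shift_run (hm : 0 < m) (hA : ∀ v, Aᵀ *ᵥ v = 0 → v = 0)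
    (hsolve : IsApproxSolver solve) {zs : ℝ} (hz : IsGreatest (dualValues A d c) zs)
    (H : OnPath A d c (1 / 12) st) {ε Λ : ℝ} (hΛ : 0 ≤ Λ)
    (hst : 15 / 2 * st.gap ≤ ε * Real.exp Λ) :
    ∃ st₂ : PathState n m,
      WhileRun (fun r : PathState n m => ε / 3 < r.gap) (shift solve A d c) st st₂ ∧
      OnPath A d c (1 / 12) st₂ ∧ st₂.gap ≤ ε / 3 ∧ (st₂ = st ∨ ε / 5 ≤ st₂.gap) ∧
      (st₂.calls.length : ℝ) ≤ st.calls.length + (25 * √(m : ℝ) * Λ + 1) ∧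
      ∀ p ∈ st₂.calls, p ∈ st.calls ∨ p.acc = 1 / (20 * (√(2 * m : ℝ) + 1)) ∧
        ∃ (st' : PathState n m) (t : ℝ), OnPath A d c (1 / 12) st' ∧
          ε / 3 ≤ st'.gap ∧ ε / 5 ≤ t ∧
          p.mat = scaledGram (extMat A d) (extVec st'.s t) := by
  have hm' : (0 : ℝ) < m := Nat.cast_pos.2 hm
  have hsm : (1 : ℝ) ≤ √(m : ℝ) := Real.one_le_sqrt.2 (Nat.one_le_cast.2 hm)
  set S : ℕ → PathState n m := fun i => (InteriorPt.shift solve A d c)^[i] st with hS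
  have hSsucc : ∀ i, S (i + 1) = InteriorPt.shift solve A d c (S i) := fun i => by
    simp only [hS, Function.iterate_succ_apply']
  have hon : ∀ i, OnPath A d c (1 / 12) (S i) := by
    intro i
    induction i with
    | zero => exact H
    | succ i ih => rw [hSsucc]; exact (ih.shift hm hA hsolve).1
  have hzsucc : ∀ i, (S (i + 1)).z = (S i).z + (S i).gap / (10 * √(m : ℝ)) := fun i => by
    rw [hSsucc]; rfl
  have hDgap : ∀ i, zs - (S i).z ≤ 5 / 2 * (S i).gap := fun i => (hon i).le_gap le_rfl hm hz
  have hgapD : ∀ i, (S i).gap ≤ zs - (S i).z := fun i => (hon i).gap_le hz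
  have hdecay : ∀ i, zs - (S (i + 1)).z ≤ (zs - (S i).z) * (1 - 1 / (25 * √(m : ℝ))) := by
    intro i
    have h2 : (zs - (S i).z) * (1 / (25 * √(m : ℝ))) ≤ (S i).gap / (10 * √(m : ℝ)) :=
      calc (zs - (S i).z) * (1 / (25 * √(m : ℝ)))
          ≤ 5 / 2 * (S i).gap * (1 / (25 * √(m : ℝ))) :=
            mul_le_mul_of_nonneg_right (hDgap i) (by positivity)
        _ = (S i).gap / (10 * √(m : ℝ)) := by field_simp; ring
    rw [hzsucc]
    linarith
  have hexp := le_exp_of_contraction (a := fun i => zs - (S i).z)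
    (fun i => (hon i).gap_pos.le.trans (hgapD i)) hdecay
  set N := ⌈25 * √(m : ℝ) * Λ⌉₊ with hN
  have hNge : 25 * √(m : ℝ) * Λ ≤ N := Nat.le_ceil _
  have hNlt : (N : ℝ) < 25 * √(m : ℝ) * Λ + 1 := Nat.ceil_lt_add_one (by positivity)
  have hexit : ¬ ε / 3 < (S N).gap := by
    rw [not_lt]
    have h1 : zs - (S N).z ≤ 5 / 2 * st.gap * Real.exp (-Λ) := by
      refine (hexp N).trans (mul_le_mul (hDgap 0) ?_ (Real.exp_pos _).le
        (by have := H.gap_pos; positivity))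
      refine Real.exp_le_exp.2 (neg_le_neg ?_)
      calc Λ = 1 / (25 * √(m : ℝ)) * (25 * √(m : ℝ) * Λ) := by field_simp
        _ ≤ _ := mul_le_mul_of_nonneg_left hNge (by positivity)
    have h2 : 5 / 2 * st.gap * Real.exp (-Λ) ≤ ε / 3 := by
      rw [Real.exp_neg, ← div_eq_mul_inv, div_le_iff₀ (Real.exp_pos Λ)]
      linarith
    linarith [hgapD N]
  obtain ⟨k, hkN, hrun, hnot, hall⟩ := exists_whileRun
    (guard := fun r : PathState n m => ε / 3 < r.gap)
    (body := InteriorPt.shift solve A d c) N st hexit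
  obtain ⟨hlen, hcalls⟩ := iterate_calls (body := InteriorPt.shift solve A d c)
    (Q := fun st => newtonQuery (extMat A d) (extVec c (-(st.z + st.gap / (10 * √(m : ℝ))))) st.y)
    (fun _ => rfl) k st
  refine ⟨S k, hrun, hon k, not_lt.1 hnot, ?_, ?_, fun p hp => ?_⟩
  · cases k with
    | zero => exact Or.inl rfl
    | succ k =>
      right
      have h1 := ((hon k).shift hm hA hsolve).2
      have h2 : ε / 3 < (S k).gap := hall k (Nat.lt_succ_self k)
      rw [hSsucc]
      linarith [(hon k).gap_pos]
  · simp only [hS]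
    rw [hlen]
    have : (k : ℝ) ≤ N := Nat.cast_le.2 hkN
    push_cast
    linarith
  · rcases hcalls p hp with h | ⟨i, hi, rfl⟩
    · exact Or.inl h
    · have h2 : ε / 3 < (S i).gap := hall i hi
      refine Or.inr ⟨acc_eq A d _ _, S i, _, hon i, h2.le, ?_, newtonQuery_mat (hon i) _⟩
      change ε / 5 ≤ d ⬝ᵥ (S i).y - ((S i).z + (S i).gap / (10 * √(m : ℝ)))
      have h3 : (S i).gap / (10 * √(m : ℝ)) ≤ (S i).gap * (1 / 10) := by
        rw [div_eq_mul_one_div]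
        exact mul_le_mul_of_nonneg_left (inv_ten_sqrt_le hm) (hon i).gap_pos.le
      linarith [(hon i).gap_eq, (hon i).gap_pos]

end Phases

/-! ### The primal output -/

section Output

variable {n m : ℕ} {A : Matrix (Fin n) (Fin m) ℝ} {b : Fin n → ℝ} {c : Fin m → ℝ}
  {st : PathState n m}

/-- The output read off from an approximate solution `v` of the last linear system. With `u` the
approximate projection `S̃⁻¹ Ãᵀ v`, it is the vector `S̃⁻¹ (1 - u)` divided by the sum of its
gap entries; replacing `u` by the exact projection would make `A x = b` exact. -/
lemma primalOutput_spec (hn : 0 < n) (hm : 0 < m) (hA : ∀ v, Aᵀ *ᵥ v = 0 → v = 0)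
    {solve : Solver n} (hsolve : IsApproxSolver solve) {T U σ δ : ℝ} (hT1 : 1 ≤ T)
    (hT : DualBounded A c T) (hU : 0 < U) (hAU : ∀ i j, |A i j| ≤ U) (hbU : ∀ i, |b i| ≤ U)
    (H : OnPath A b c (1 / 12) st) (hσ : 0 < σ) (hσs : ∀ k, σ ≤ extVec st.s st.gap k)
    (hδ0 : 0 < δ) (hδ1 : δ ≤ 1) (hδ : δ ≤ σ / (T * U) * (√(m : ℝ) / n)) {v : Fin n → ℝ}
    (hv : v = solve (scaledGram (extMat A b) (extVec st.s st.gap))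
      (extMat A b *ᵥ (extVec st.s st.gap)⁻¹) δ) :
    (∀ j, 0 < primalOutput A b st v j) ∧
      l2norm (A *ᵥ primalOutput A b st v - b) ≤ 1 / 6 * st.gap ∧
      c ⬝ᵥ primalOutput A b st v ≤ b ⬝ᵥ st.y + 2 * st.gap := by
  have hm' : (0 : ℝ) < m := Nat.cast_pos.2 hm
  have hn' : (0 : ℝ) < n := Nat.cast_pos.2 hn
  have hT0 : 0 < T := by linarith
  have hg := H.gap_pos
  set B := extMat A b with hB
  set s := extVec st.s st.gap with hs
  have hBinj := extMat_transpose_injective hA b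
  have hspos : ∀ k, 0 < s k := extVec_pos H.slack_pos hg
  obtain ⟨hker, hqη⟩ := newtonProj_spec hBinj hspos H.central rfl
  have happ := approx_proj hBinj hspos hsolve hδ0 (B *ᵥ s⁻¹)
  rw [← hv] at happ
  set q := s⁻¹ * (Bᵀ *ᵥ ((scaledGram B s)⁻¹ *ᵥ (B *ᵥ s⁻¹))) with hq
  set u := s⁻¹ * (Bᵀ *ᵥ v) with hu
  have hqu : l2norm (q - u) ≤ δ * (1 / 12) := by
    have h1 : q - u = (-1 : ℝ) • (u - q) := by rw [neg_one_smul, neg_sub]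
    rw [h1, l2norm_smul, abs_neg, abs_one, one_mul]
    exact happ.trans (mul_le_mul_of_nonneg_left hqη hδ0.le)
  have hu6 : ∀ k, |u k| ≤ 1 / 6 := fun k => by
    have h1 : u = q - (q - u) := by abel
    have h2 : l2norm u ≤ 1 / 6 := by
      rw [h1]
      refine (l2norm_sub_le _ _).trans ?_
      linarith
    exact (abs_le_l2norm u k).trans h2
  have hul : ∀ j, u (Sum.inl j) = (st.s j)⁻¹ * (Aᵀ *ᵥ v) j := fun j => by
    rw [hu, hB, extMat_transpose_mulVec]; rfl
  have hur : ∀ j, u (Sum.inr j) = st.gap⁻¹ * (-(b ⬝ᵥ v)) := fun j => by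
    rw [hu, hB, extMat_transpose_mulVec]; rfl
  set γ := u (Sum.inr ⟨0, hm⟩) with hγ
  have hγr : ∀ j, u (Sum.inr j) = γ := fun j => by rw [hγ, hur, hur]
  have hγ1 : 5 / 6 ≤ 1 - γ := by linarith [(abs_le.1 (hu6 (Sum.inr ⟨0, hm⟩))).2]
  -- the normalizing factor
  set D := (m : ℝ) * (st.gap⁻¹ * (1 - γ)) with hD
  have hD0 : 0 < D := mul_pos hm' (mul_pos (inv_pos.2 hg) (by linarith))
  have hDinv : D⁻¹ ≤ 6 / 5 * st.gap / m := by
    rw [inv_le_iff_one_le_mul₀ hD0, hD]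
    have : 6 / 5 * st.gap / m * (m * (st.gap⁻¹ * (1 - γ))) = 6 / 5 * (1 - γ) := by field_simp
    rw [this]
    linarith
  have hx : primalOutput A b st v = D⁻¹ • (fun j => (st.s j)⁻¹ * (1 - u (Sum.inl j))) := by
    ext j
    have e1 : (m : ℝ) * (st.gap⁻¹ + (st.gap ^ 2)⁻¹ * (b ⬝ᵥ v)) = D := by
      rw [hD, hγ, hur]; field_simp; ring
    simp only [primalOutput, e1, Pi.smul_apply, smul_eq_mul, hul]
    have := (H.slack_pos j).ne'
    field_simp
  set x' : Fin m → ℝ := fun j => (st.s j)⁻¹ * (1 - u (Sum.inl j)) with hx'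
  have hx'pos : ∀ j, 0 < x' j := fun j =>
    mul_pos (inv_pos.2 (H.slack_pos j)) (by linarith [(abs_le.1 (hu6 (Sum.inl j))).2])
  -- the residual comes from the difference of the exact and the approximate projection
  have hres : A *ᵥ x' - D • b = B *ᵥ (s⁻¹ * (q - u)) := by
    have h1 : s⁻¹ * (q - u) = s⁻¹ * (1 - u) - s⁻¹ * (1 - q) := by ring
    rw [h1, mulVec_sub, hker, sub_zero, hB, extMat_mulVec]
    have h2 : (s⁻¹ * (1 - u)) ∘ Sum.inl = x' := rfl
    have h3 : ∑ j : Fin m, (s⁻¹ * (1 - u)) (Sum.inr j) = D := by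
      have : ∀ j : Fin m, (s⁻¹ * (1 - u)) (Sum.inr j) = st.gap⁻¹ * (1 - γ) := fun j => by
        simp only [Pi.mul_apply, Pi.inv_apply, Pi.sub_apply, Pi.one_apply, hγr]
        rfl
      simp only [this, Finset.sum_const, Finset.card_univ, Fintype.card_fin, nsmul_eq_mul, hD]
    rw [h2, h3]
  have hBU : ∀ i k, |B i k| ≤ U := by
    intro i k
    cases k with
    | inl j => exact hAU i j
    | inr j =>
      have : B i (Sum.inr j) = -b i := rfl
      rw [this, abs_neg]
      exact hbU i
  have hAx : A *ᵥ primalOutput A b st v - b = D⁻¹ • (B *ᵥ (s⁻¹ * (q - u))) := by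
    rw [← hres, hx, mulVec_smul, smul_sub, smul_smul, inv_mul_cancel₀ hD0.ne', one_smul]
  have hsn : 0 < √(n : ℝ) := Real.sqrt_pos.2 hn'
  have hsm : 0 < √(m : ℝ) := Real.sqrt_pos.2 hm'
  have hnn : √(n : ℝ) * √n = n := Real.mul_self_sqrt hn'.le
  have hmm : √(m : ℝ) * √m = m := Real.mul_self_sqrt hm'.le
  have hnorm : T * √n * l2norm (A *ᵥ primalOutput A b st v - b) ≤ 1 / 6 * st.gap := by
    have h1 : l2norm (s⁻¹ * (q - u)) ≤ σ⁻¹ * (δ * (1 / 12)) := by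
      refine le_trans ?_ (mul_le_mul_of_nonneg_left hqu (inv_pos.2 hσ).le)
      rw [← abs_of_pos (inv_pos.2 hσ), ← l2norm_smul]
      refine l2norm_mono fun k => ?_
      simp only [Pi.mul_apply, Pi.inv_apply, Pi.smul_apply, smul_eq_mul, abs_mul,
        abs_of_pos (inv_pos.2 (hspos k)), abs_of_pos (inv_pos.2 hσ)]
      exact mul_le_mul_of_nonneg_right (inv_anti₀ hσ (hσs k)) (abs_nonneg _)
    have h2 := l2norm_mulVec_le hU.le hBU (s⁻¹ * (q - u))
    have hcard : √(Fintype.card (Fin m ⊕ Fin m) : ℝ) ≤ 3 / 2 * √m := by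
      rw [Fintype.card_sum, Fintype.card_fin, Real.sqrt_le_left (by positivity), mul_pow,
        Real.sq_sqrt hm'.le]
      push_cast
      linarith
    have h3 : l2norm (B *ᵥ (s⁻¹ * (q - u))) ≤ m / (8 * (T * √n)) := by
      refine h2.trans ?_
      have h4 : σ⁻¹ * (δ * (1 / 12)) ≤ √m / (12 * (T * U * n)) := by
        calc σ⁻¹ * (δ * (1 / 12)) ≤ σ⁻¹ * (σ / (T * U) * (√(m : ℝ) / n) * (1 / 12)) := by gcongr
          _ = _ := by field_simp
      calc √n * (√(Fintype.card (Fin m ⊕ Fin m) : ℝ) * U * l2norm (s⁻¹ * (q - u)))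
          ≤ √n * (3 / 2 * √m * U * (√m / (12 * (T * U * n)))) := by
            refine mul_le_mul_of_nonneg_left ?_ hsn.le
            exact mul_le_mul (mul_le_mul_of_nonneg_right hcard hU.le) (h1.trans h4)
              (l2norm_nonneg _) (by positivity)
        _ = (√m * √m) * √n / (8 * (T * (√n * √n))) := by rw [hnn]; field_simp; norm_num
        _ = m / (8 * (T * √n)) := by rw [hmm]; field_simp
    rw [hAx, l2norm_smul, abs_of_pos (inv_pos.2 hD0)]
    calc T * √n * (D⁻¹ * l2norm (B *ᵥ (s⁻¹ * (q - u))))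
        ≤ T * √n * ((6 / 5 * st.gap / m) * (m / (8 * (T * √n)))) := by
          refine mul_le_mul_of_nonneg_left ?_ (by positivity)
          exact mul_le_mul hDinv h3 (l2norm_nonneg _) (by positivity)
      _ = 3 / 20 * st.gap := by field_simp; norm_num
      _ ≤ _ := by linarith
  refine ⟨fun j => ?_, ?_, ?_⟩
  · rw [hx]
    exact mul_pos (inv_pos.2 hD0) (hx'pos j)
  · refine le_trans ?_ hnorm
    have h1 : (1 : ℝ) ≤ √n := Real.one_le_sqrt.2 (Nat.one_le_cast.2 hn)
    exact le_mul_of_one_le_left (l2norm_nonneg _) (one_le_mul_of_one_le_of_one_le hT1 h1)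
  · set x := primalOutput A b st v with hxdef
    have h1 : c ⬝ᵥ x = b ⬝ᵥ st.y + st.y ⬝ᵥ (A *ᵥ x - b) + st.s ⬝ᵥ x := by
      rw [H.slack, sub_dotProduct, dotProduct_sub, dotProduct_mulVec_eq, dotProduct_comm b]
      ring
    have h2 : st.y ⬝ᵥ (A *ᵥ x - b) ≤ 1 / 6 * st.gap := by
      refine (dotProduct_le _ _).trans (le_trans ?_ hnorm)
      refine mul_le_mul_of_nonneg_right ?_ (l2norm_nonneg _)
      have := l2norm_le_of_abs_le hT0.le (H.slack_bounds hT).1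
      rw [Fintype.card_fin] at this
      linarith
    have h3 : st.s ⬝ᵥ x ≤ 7 / 5 * st.gap := by
      have h4 : st.s ⬝ᵥ x' ≤ m * (7 / 6) := by
        have : ∑ j, st.s j * x' j ≤ ∑ _j : Fin m, (7 / 6 : ℝ) := Finset.sum_le_sum fun j _ => by
          rw [hx', mul_inv_cancel_left₀ (H.slack_pos j).ne']
          linarith [(abs_le.1 (hu6 (Sum.inl j))).1]
        simpa only [dotProduct, Finset.sum_const, Finset.card_univ, Fintype.card_fin,
          nsmul_eq_mul] using this
      rw [hx, dotProduct_smul, smul_eq_mul]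
      calc D⁻¹ * (st.s ⬝ᵥ x') ≤ D⁻¹ * (m * (7 / 6)) :=
            mul_le_mul_of_nonneg_left h4 (inv_pos.2 hD0).le
        _ ≤ 6 / 5 * st.gap / m * (m * (7 / 6)) := mul_le_mul_of_nonneg_right hDinv (by positivity)
        _ = 7 / 5 * st.gap := by field_simp
    linarith

end Output

/-! ### Bounds on the data and the iterates -/

section Magnitudes

variable {n m : ℕ} {A : Matrix (Fin n) (Fin m) ℝ} {b : Fin n → ℝ} {c : Fin m → ℝ}
  {lam T ε : ℝ} {y0 : Fin n → ℝ}

lemma abs_le_maxEntry_matrix (i : Fin n) (j : Fin m) : |A i j| ≤ maxEntry A b c :=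
  (le_ciSup (f := fun p : Fin n × Fin m => |A p.1 p.2|) (Set.finite_range _).bddAbove (i, j)).trans
    (le_max_left _ _)

lemma abs_le_maxEntry_objective (i : Fin n) : |b i| ≤ maxEntry A b c :=
  (le_ciSup (f := fun i => |b i|) (Set.finite_range _).bddAbove i).trans
    ((le_max_left _ _).trans (le_max_right _ _))

lemma abs_le_maxEntry_constraint (j : Fin m) : |c j| ≤ maxEntry A b c :=
  (le_ciSup (f := fun j => |c j|) (Set.finite_range _).bddAbove j).trans
    ((le_max_right _ _).trans (le_max_right _ _))

lemma minSlack_le (j : Fin m) : minSlack A c y0 ≤ (c - Aᵀ *ᵥ y0) j :=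
  ciInf_le (f := fun j => (c - Aᵀ *ᵥ y0) j) (Set.finite_range _).bddBelow j

lemma sqrt_mul_sqrt_natCast (m : ℕ) : √(m : ℝ) * √m = m := Real.mul_self_sqrt (Nat.cast_nonneg m)

lemma gapBound_eq : gapBound m lam T b = 40 * T * m * l2norm b / √lam := by
  rw [gapBound, enorm2_eq_l2norm]
  ring

/-- The data of the theorem: a bounded dual polytope with an interior point `y0`, a nonzero
objective, a lower bound `lam` on the spectrum of `A Aᵀ`, and an accuracy `ε`. -/
structure Setting (A : Matrix (Fin n) (Fin m) ℝ) (b : Fin n → ℝ) (c : Fin m → ℝ) (lam T : ℝ)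
    (y0 : Fin n → ℝ) (ε : ℝ) : Prop where
  posDef : (A * Aᵀ).PosDef
  b_ne : b ≠ 0
  lam_pos : 0 < lam
  lam_le : ∀ i, lam ≤ posDef.isHermitian.eigenvalues i
  one_le_T : 1 ≤ T
  bounded : DualBounded A c T
  interior : ∀ j, (Aᵀ *ᵥ y0) j < c j
  eps_pos : 0 < ε
  eps_lt : ε < 1

namespace Setting

variable (S : Setting A b c lam T y0 ε)
include S

lemma n_pos : 0 < n := by
  obtain ⟨i, -⟩ := Function.ne_iff.1 S.b_ne
  exact i.pos

lemma two_le : 2 ≤ m := two_le_of_dualBounded S.n_pos S.posDef S.bounded S.interior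

lemma m_pos : 0 < m := by have := S.two_le; omega

lemma two_le_cast : (2 : ℝ) ≤ m := by exact_mod_cast S.two_le

lemma n_le_m : (n : ℝ) ≤ m := Nat.cast_le.2 (card_le_of_posDef S.posDef)

lemma sqrt_n_le : √(n : ℝ) ≤ √m := Real.sqrt_le_sqrt S.n_le_m

lemma T_pos : 0 < T := by linarith [S.one_le_T]

lemma injective (v : Fin n → ℝ) (hv : Aᵀ *ᵥ v = 0) : v = 0 :=
  transpose_mulVec_injective S.posDef v hv

lemma U_pos : 0 < maxEntry A b c := by
  obtain ⟨i, hi⟩ := Function.ne_iff.1 S.b_ne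
  exact (abs_pos.2 hi).trans_le (abs_le_maxEntry_objective i)

lemma minSlack_pos : 0 < minSlack A c y0 := by
  have : Nonempty (Fin m) := ⟨⟨0, S.m_pos⟩⟩
  obtain ⟨j, hj⟩ := exists_eq_ciInf_of_finite (f := fun j => (c - Aᵀ *ᵥ y0) j)
  rw [minSlack, ← hj]
  simpa using S.interior j

lemma sqrt_lam_pos : 0 < √lam := Real.sqrt_pos.2 S.lam_pos

lemma sqrt_lam_le : √lam ≤ √m * maxEntry A b c := by
  set e : Fin n → ℝ := Pi.single ⟨0, S.n_pos⟩ 1 with he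
  have h1 := sqrt_mul_l2norm_le S.posDef S.lam_le e
  have h2 : l2norm e = 1 := by
    rw [l2norm, he]
    have : ∀ k, (Pi.single (⟨0, S.n_pos⟩ : Fin n) (1 : ℝ) : Fin n → ℝ) k ^ 2
        = (Pi.single (⟨0, S.n_pos⟩ : Fin n) (1 : ℝ) : Fin n → ℝ) k := fun k => by
      by_cases h : k = ⟨0, S.n_pos⟩
      · subst h; simp
      · simp [h]
    simp [this]
  have h3 := l2norm_le_of_abs_le (v := Aᵀ *ᵥ e) S.U_pos.le fun j => by
    rw [he]
    simpa using abs_le_maxEntry_matrix (A := A) (b := b) (c := c) ⟨0, S.n_pos⟩ j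
  rw [h2, mul_one] at h1
  rw [Fintype.card_fin] at h3
  exact h1.trans h3

lemma norm_b_pos : 0 < l2norm b := l2norm_pos S.b_ne

lemma norm_b_le : l2norm b ≤ √m * maxEntry A b c := by
  have := l2norm_le_of_abs_le S.U_pos.le
    (fun i => abs_le_maxEntry_objective (A := A) (b := b) (c := c) i)
  rw [Fintype.card_fin] at this
  exact this.trans (mul_le_mul_of_nonneg_right S.sqrt_n_le S.U_pos.le)

lemma norm_auxObj_le :
    l2norm (auxObj A c y0) ≤ √m * (m * maxEntry A b c / minSlack A c y0) := by
  have hU := S.U_pos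
  have hμ := S.minSlack_pos
  have h := l2norm_le_of_abs_le (v := auxObj A c y0)
    (r := m * maxEntry A b c / minSlack A c y0) (by positivity) fun i => by
      rw [auxObj, mulVec, dotProduct]
      refine (Finset.abs_sum_le_sum_abs _ _).trans ?_
      have h1 : ∑ j, |A i j * ((c - Aᵀ *ᵥ y0) j)⁻¹|
          ≤ ∑ _j : Fin m, maxEntry A b c / minSlack A c y0 :=
        Finset.sum_le_sum fun j _ => by
          rw [abs_mul, div_eq_mul_inv, abs_of_nonneg (inv_nonneg.2 (hμ.le.trans (minSlack_le j)))]
          exact mul_le_mul (abs_le_maxEntry_matrix i j) (inv_anti₀ hμ (minSlack_le j))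
            (inv_nonneg.2 (hμ.le.trans (minSlack_le j))) hU.le
      refine h1.trans (le_of_eq ?_)
      simp only [Finset.sum_const, Finset.card_univ, Fintype.card_fin, nsmul_eq_mul]
      ring
  rw [Fintype.card_fin] at h
  exact h.trans (mul_le_mul_of_nonneg_right S.sqrt_n_le (by positivity))

variable {d : Fin n → ℝ} {h : ℝ} {st : PathState n m}

lemma slack_le (H : OnPath A d c h st) (j : Fin m) :
    st.s j ≤ T ∧ st.s j ≤ 2 * m * maxEntry A b c * T := by
  refine ⟨(H.slack_bounds S.bounded).2 j, ?_⟩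
  have hU := S.U_pos
  have h1 : |(Aᵀ *ᵥ st.y) j| ≤ ∑ _i : Fin n, maxEntry A b c * T := by
    rw [mulVec, dotProduct]
    refine (Finset.abs_sum_le_sum_abs _ _).trans (Finset.sum_le_sum fun i _ => ?_)
    rw [abs_mul]
    exact mul_le_mul (abs_le_maxEntry_matrix i j) ((H.slack_bounds S.bounded).1 i) (abs_nonneg _)
      hU.le
  simp only [Finset.sum_const, Finset.card_univ, Fintype.card_fin, nsmul_eq_mul] at h1
  have h2 := (abs_le.1 (abs_le_maxEntry_constraint (A := A) (b := b) (c := c) j)).2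
  have h3 : st.s j = c j - (Aᵀ *ᵥ st.y) j := by rw [H.slack]; rfl
  have hUT : maxEntry A b c ≤ maxEntry A b c * T := le_mul_of_one_le_right hU.le S.one_le_T
  have h4 : (n : ℝ) * (maxEntry A b c * T) ≤ m * (maxEntry A b c * T) :=
    mul_le_mul_of_nonneg_right S.n_le_m (by linarith)
  have h5 : maxEntry A b c * T ≤ m * (maxEntry A b c * T) :=
    le_mul_of_one_le_left (by linarith) (by linarith [S.two_le_cast])
  linarith [(abs_le.1 h1).1]

lemma interior_bound (i : Fin n) : |y0 i| ≤ T :=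
  (S.bounded y0 _ rfl fun j => by simpa using (S.interior j).le).1 i

lemma interior_slack_le (j : Fin m) : (c - Aᵀ *ᵥ y0) j ≤ T :=
  (le_abs_self _).trans ((S.bounded y0 _ rfl fun j => by simpa using (S.interior j).le).2 j)

/-- Objective values at two points of the polytope differ by at most `2 m U T`. -/
lemma objective_diff_le (H : OnPath A d c h st) :
    b ⬝ᵥ st.y - b ⬝ᵥ y0 ≤ 2 * m * maxEntry A b c * T := by
  have hU := S.U_pos
  have hT := S.T_pos
  rw [← dotProduct_sub]
  have h1 : b ⬝ᵥ (st.y - y0) ≤ ∑ _i : Fin n, maxEntry A b c * (2 * T) := by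
    refine Finset.sum_le_sum fun i _ => (le_abs_self _).trans ?_
    rw [abs_mul]
    refine mul_le_mul (abs_le_maxEntry_objective i) ?_ (abs_nonneg _) hU.le
    rw [Pi.sub_apply]
    have := abs_sub (st.y i) (y0 i)
    linarith [(H.slack_bounds S.bounded).1 i, S.interior_bound i]
  simp only [Finset.sum_const, Finset.card_univ, Fintype.card_fin, nsmul_eq_mul] at h1
  have h4 : (n : ℝ) * (maxEntry A b c * (2 * T)) ≤ m * (maxEntry A b c * (2 * T)) :=
    mul_le_mul_of_nonneg_right S.n_le_m (by positivity)
  linarith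

/-- Slacks determine `y` up to the factor `λ_min^{-1/2}`, so objective values at two points of the
polytope differ by less than the initial gap of the second phase. -/
lemma objective_diff_le_gapBound (H : OnPath A d c h st) :
    b ⬝ᵥ st.y - b ⬝ᵥ y0 ≤ gapBound m lam T b := by
  have hl := S.sqrt_lam_pos
  have hT := S.T_pos
  have hm : (0 : ℝ) < m := Nat.cast_pos.2 S.m_pos
  rw [← dotProduct_sub]
  have h1 := sqrt_mul_l2norm_le S.posDef S.lam_le (st.y - y0)
  have h2 : l2norm (Aᵀ *ᵥ (st.y - y0)) ≤ √m * T := by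
    have := l2norm_le_of_abs_le (v := Aᵀ *ᵥ (st.y - y0)) hT.le fun j => by
      have e : (Aᵀ *ᵥ (st.y - y0)) j = (c - Aᵀ *ᵥ y0) j - st.s j := by
        rw [H.slack, mulVec_sub]; simp
      rw [e, abs_le]
      have a1 := S.interior_slack_le j
      have a2 := (H.slack_bounds S.bounded).2 j
      have a3 := H.slack_pos j
      have a4 := S.minSlack_pos.trans_le (minSlack_le j)
      constructor <;> linarith
    rwa [Fintype.card_fin] at this
  have hsm : √(m : ℝ) ≤ m := by
    rw [Real.sqrt_le_left hm.le]
    nlinarith [S.two_le_cast]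
  have h3 : l2norm (st.y - y0) ≤ (√lam)⁻¹ * (m * T) := by
    rw [← div_eq_inv_mul, le_div_iff₀ hl]
    have := mul_le_mul_of_nonneg_right hsm hT.le
    linarith
  refine (dotProduct_le _ _).trans ((mul_le_mul_of_nonneg_left h3 (l2norm_nonneg _)).trans ?_)
  rw [gapBound, enorm2_eq_l2norm]
  have h4 : 0 ≤ l2norm b * ((√lam)⁻¹ * (m * T)) := by have := l2norm_nonneg b; positivity
  nlinarith

/-- The lower bound on the slacks that holds at every iterate at which a solver call is made. The
hypothesis on `d` holds in the first phase because `z` only decreases, and in the second because the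
gap is at least `ε / 5` or still has its initial value. -/
lemma minSlack_le_mul (H : OnPath A d c h st) (h12 : h ≤ 1 / 12)
    (hd : d ⬝ᵥ st.y - d ⬝ᵥ y0 ≤ (1 + 10 * m * maxEntry A b c * T / ε) * st.gap) (j : Fin m) :
    minSlack A c y0 ≤ 2 * m * (2 + 10 * m * maxEntry A b c * T / ε) * st.s j := by
  have hU := S.U_pos
  have hT := S.T_pos
  have hε := S.eps_pos
  refine (minSlack_le j).trans ((H.le_slack h12 S.interior (by positivity) hd j).trans (le_of_eq ?_))
  ring

lemma diagCond_le (H : OnPath A d c h st) (h12 : h ≤ 1 / 12)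
    (hd : d ⬝ᵥ st.y - d ⬝ᵥ y0 ≤ (1 + 10 * m * maxEntry A b c * T / ε) * st.gap) :
    diagCond st.s ≤ 28 * (T ^ 2 * maxEntry A b c * m ^ 2 / (minSlack A c y0 * ε)) := by
  have hU := S.U_pos
  have hT := S.T_pos
  have hε := S.eps_pos
  have hμ := S.minSlack_pos
  have hm : (0 : ℝ) < m := Nat.cast_pos.2 S.m_pos
  have : Nonempty (Fin m) := ⟨⟨0, S.m_pos⟩⟩
  obtain ⟨j, hj⟩ := exists_eq_ciInf_of_finite (f := st.s)
  obtain ⟨i, hi⟩ := exists_eq_ciSup_of_finite (f := st.s)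
  rw [diagCond, ← hj, ← hi, div_le_iff₀ (H.slack_pos j)]
  have h1 := S.minSlack_le_mul H h12 hd j
  obtain ⟨h2, h3⟩ := S.slack_le H i
  have h4 : st.s i * (2 * m * (2 + 10 * m * maxEntry A b c * T / ε))
      ≤ 28 * (T ^ 2 * maxEntry A b c * m ^ 2 / ε) := by
    have e1 : st.s i * (4 * m) ≤ 8 * (T ^ 2 * maxEntry A b c * m ^ 2 / ε) :=
      calc st.s i * (4 * m) ≤ 2 * m * maxEntry A b c * T * (4 * m) :=
            mul_le_mul_of_nonneg_right h3 (by positivity)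
        _ = 8 * (1 * T * maxEntry A b c * m ^ 2 / 1) := by ring
        _ ≤ 8 * (T * T * maxEntry A b c * m ^ 2 / ε) := by
            gcongr
            · exact S.one_le_T
            · exact S.eps_lt.le
        _ = _ := by ring
    have e2 : st.s i * (20 * (m ^ 2 * maxEntry A b c * T / ε))
        ≤ T * (20 * (m ^ 2 * maxEntry A b c * T / ε)) :=
      mul_le_mul_of_nonneg_right h2 (by positivity)
    have e3 : T * (20 * (m ^ 2 * maxEntry A b c * T / ε))
        = 20 * (T ^ 2 * maxEntry A b c * m ^ 2 / ε) := by ring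
    have e4 : st.s i * (2 * m * (2 + 10 * m * maxEntry A b c * T / ε))
        = st.s i * (4 * m) + st.s i * (20 * (m ^ 2 * maxEntry A b c * T / ε)) := by ring
    linarith
  have h5 : st.s i * minSlack A c y0
      ≤ 28 * (T ^ 2 * maxEntry A b c * m ^ 2 / ε) * st.s j :=
    calc st.s i * minSlack A c y0
        ≤ st.s i * (2 * m * (2 + 10 * m * maxEntry A b c * T / ε) * st.s j) :=
          mul_le_mul_of_nonneg_left h1 (H.slack_pos i).le
      _ = st.s i * (2 * m * (2 + 10 * m * maxEntry A b c * T / ε)) * st.s j := by ring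
      _ ≤ _ := mul_le_mul_of_nonneg_right h4 (H.slack_pos j).le
  calc st.s i = st.s i * minSlack A c y0 / minSlack A c y0 := by field_simp
    _ ≤ 28 * (T ^ 2 * maxEntry A b c * m ^ 2 / ε) * st.s j / minSlack A c y0 := by gcongr
    _ = _ := by field_simp

end Setting

/-! ### The scales of the logarithmic bounds -/

/-- The quantity whose logarithm bounds the number of solver calls. -/
noncomputable def iterScale (A : Matrix (Fin n) (Fin m) ℝ) (b : Fin n → ℝ) (c : Fin m → ℝ)
    (lam T : ℝ) (y0 : Fin n → ℝ) (ε : ℝ) : ℝ :=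
  T * maxEntry A b c * m / (√lam * min 1 (minSlack A c y0) * ε)

/-- The quantity whose logarithm bounds the size and the accuracy of the solver calls. -/
noncomputable def callScale (A : Matrix (Fin n) (Fin m) ℝ) (b : Fin n → ℝ) (c : Fin m → ℝ)
    (T : ℝ) (y0 : Fin n → ℝ) (ε : ℝ) : ℝ :=
  T * maxEntry A b c * m / (min 1 (minSlack A c y0) * min ε (enorm2 b))

namespace Setting

variable (S : Setting A b c lam T y0 ε)
include S

lemma TUm_pos : 0 < T * maxEntry A b c * m :=
  mul_pos (mul_pos S.T_pos S.U_pos) (Nat.cast_pos.2 S.m_pos)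

lemma U_mul_m_le : maxEntry A b c * m ≤ T * maxEntry A b c * m := by
  have h := S.U_pos
  rw [mul_assoc]
  exact le_mul_of_one_le_left (by positivity) S.one_le_T

lemma min_one_minSlack_pos : 0 < min 1 (minSlack A c y0) := lt_min one_pos S.minSlack_pos

lemma le_iterScale {a : ℝ} (ha : √lam * min 1 (minSlack A c y0) * ε ≤ a) :
    T * maxEntry A b c * m / a ≤ iterScale A b c lam T y0 ε :=
  div_le_div_of_nonneg_left S.TUm_pos.le
    (mul_pos (mul_pos S.sqrt_lam_pos S.min_one_minSlack_pos) S.eps_pos) ha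

lemma le_callScale {a : ℝ} (ha : min 1 (minSlack A c y0) * min ε (enorm2 b) ≤ a) :
    T * maxEntry A b c * m / a ≤ callScale A b c T y0 ε := by
  refine div_le_div_of_nonneg_left S.TUm_pos.le
    (mul_pos S.min_one_minSlack_pos (lt_min S.eps_pos ?_)) ha
  rw [enorm2_eq_l2norm]
  exact S.norm_b_pos

lemma sqrt_m_pos : 0 < √(m : ℝ) := Real.sqrt_pos.2 (Nat.cast_pos.2 S.m_pos)

lemma sqrt_m_le_div {a : ℝ} (ha : 0 < a) (ha' : a ≤ √m * maxEntry A b c) :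
    √m ≤ T * maxEntry A b c * m / a := by
  rw [le_div_iff₀ ha]
  calc √m * a ≤ √m * (√m * maxEntry A b c) := mul_le_mul_of_nonneg_left ha' S.sqrt_m_pos.le
    _ = maxEntry A b c * m := by rw [← mul_assoc, sqrt_mul_sqrt_natCast, mul_comm]
    _ ≤ _ := S.U_mul_m_le

/-- The eigenvalue bound `√λ_min ≤ √m U` makes the scale at least `√m`, so that its logarithm
absorbs powers of `m` and constants. -/
lemma sqrt_m_le_iterScale : √m ≤ iterScale A b c lam T y0 ε := by
  refine (S.sqrt_m_le_div S.sqrt_lam_pos S.sqrt_lam_le).trans (S.le_iterScale ?_)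
  have h1 : min 1 (minSlack A c y0) * ε ≤ 1 :=
    mul_le_one₀ (min_le_left _ _) S.eps_pos.le S.eps_lt.le
  rw [mul_assoc]
  exact mul_le_of_le_one_right S.sqrt_lam_pos.le h1

/-- The analogue for the second scale, from `‖b‖ ≤ √m U`. -/
lemma sqrt_m_le_callScale : √m ≤ callScale A b c T y0 ε := by
  refine (S.sqrt_m_le_div S.norm_b_pos S.norm_b_le).trans (S.le_callScale ?_)
  rw [enorm2_eq_l2norm]
  calc min 1 (minSlack A c y0) * min ε (l2norm b) ≤ 1 * l2norm b :=
        mul_le_mul (min_le_left _ _) (min_le_right _ _)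
          (le_min S.eps_pos.le S.norm_b_pos.le) zero_le_one
    _ = l2norm b := one_mul _

lemma callScale_facts :
    T * maxEntry A b c * m ≤ callScale A b c T y0 ε ∧
    T * maxEntry A b c * m / l2norm b ≤ callScale A b c T y0 ε ∧
    T * maxEntry A b c * m / minSlack A c y0 ≤ callScale A b c T y0 ε ∧
    T * maxEntry A b c * m / ε ≤ callScale A b c T y0 ε := by
  have hε := S.eps_pos
  have hε1 := S.eps_lt
  have hβ := S.norm_b_pos
  have hμ := S.min_one_minSlack_pos
  have h0 : 0 ≤ min ε (l2norm b) := le_min hε.le hβ.le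
  have h1 : min 1 (minSlack A c y0) ≤ 1 := min_le_left _ _
  have h2 : min ε (l2norm b) ≤ 1 := (min_le_left _ _).trans hε1.le
  refine ⟨?_, ?_, ?_, ?_⟩
  · have := S.le_callScale (a := 1)
      (by rw [enorm2_eq_l2norm]; exact mul_le_one₀ h1 h0 h2)
    rwa [div_one] at this
  · refine S.le_callScale ?_
    rw [enorm2_eq_l2norm]
    exact (mul_le_of_le_one_left h0 h1).trans (min_le_right _ _)
  · refine S.le_callScale ?_
    rw [enorm2_eq_l2norm]
    exact (mul_le_of_le_one_right hμ.le h2).trans (min_le_right _ _)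
  · refine S.le_callScale ?_
    rw [enorm2_eq_l2norm]
    exact (mul_le_of_le_one_left h0 h1).trans (min_le_left _ _)

lemma two_le_sq {K : ℝ} (hK : √m ≤ K) : 2 ≤ K ^ 2 := by
  have h1 := pow_le_pow_left₀ S.sqrt_m_pos.le hK 2
  rw [Real.sq_sqrt (Nat.cast_nonneg m)] at h1
  linarith [S.two_le_cast]

lemma one_le_of_sqrt_m_le {K : ℝ} (hK : √m ≤ K) : 1 ≤ K :=
  (Real.one_le_sqrt.2 (by linarith [S.two_le_cast])).trans hK

lemma const_le_pow {K : ℝ} (hK : √m ≤ K) : 512 ≤ K ^ 18 := by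
  have h1 := pow_le_pow_left₀ (by norm_num) (S.two_le_sq hK) 9
  rw [← pow_mul] at h1
  norm_num at h1
  exact h1

/-- Constants and fixed powers of the scale disappear in the logarithm. At `r = 0`, where
`Real.log 0 = 0`, the bound holds because the scale is at least `1`. -/
lemma log_le_of_le {r : ℝ} (h0 : 0 ≤ r) (hr : r ≤ 500 * callScale A b c T y0 ε ^ 4) :
    Real.log r ≤ 2000 * Real.log (callScale A b c T y0 ε) := by
  set K := callScale A b c T y0 ε with hK
  have hK1 := S.one_le_of_sqrt_m_le S.sqrt_m_le_callScale
  have hlog : 0 ≤ Real.log K := Real.log_nonneg hK1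
  rcases h0.eq_or_lt with h | h
  · rw [← h, Real.log_zero]; positivity
  · have h1 : r ≤ K ^ 22 := by
      have h2 := S.const_le_pow S.sqrt_m_le_callScale
      calc r ≤ 500 * K ^ 4 := hr
        _ ≤ K ^ 18 * K ^ 4 := mul_le_mul_of_nonneg_right (by linarith) (by positivity)
        _ = K ^ 22 := by ring
    have h3 := Real.log_le_log h h1
    rw [Real.log_pow] at h3
    push_cast at h3
    linarith

/-! ### The solver calls -/

/-- The form of a solver call made at a point near the central path. The rank-one part comes from
the `m` copies of the column `-d`; its norm is at most `V`, and the requested accuracy is at least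
`1 / W`. -/
lemma call_form {d : Fin n → ℝ} {h t : ℝ} {st : PathState n m} (H : OnPath A d c h st)
    (h12 : h ≤ 1 / 12)
    (hd : d ⬝ᵥ st.y - d ⬝ᵥ y0 ≤ (1 + 10 * m * maxEntry A b c * T / ε) * st.gap) {p : Query n}
    (hp : p.mat = scaledGram (extMat A d) (extVec st.s t)) (hacc : 0 < p.acc) (ht : 0 < t)
    {V W : ℝ} (hV : √m / t * l2norm d ≤ V) (hW : p.acc⁻¹ ≤ W)
    (hVW : V * W ≤ 500 * callScale A b c T y0 ε ^ 4) :
    0 < p.acc ∧ ∃ (s : Fin m → ℝ) (v : Fin n → ℝ), (∀ j, 0 < s j) ∧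
      p.mat = scaledGram A s + vecMulVec v v ∧
      diagCond s ≤ 2000 * (T ^ 2 * maxEntry A b c * m ^ 2 / (minSlack A c y0 * ε)) ∧
      Real.log (enorm2 v / p.acc) ≤ 2000 * Real.log (callScale A b c T y0 ε) := by
  have hU := S.U_pos
  have hT := S.T_pos
  have hε := S.eps_pos
  have hμ := S.minSlack_pos
  refine ⟨hacc, st.s, (√m / t) • d, H.slack_pos, by rw [hp, scaledGram_extMat], ?_, ?_⟩
  · refine (S.diagCond_le H h12 hd).trans (mul_le_mul_of_nonneg_right (by norm_num) ?_)
    positivity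
  · have h1 : enorm2 ((√(m : ℝ) / t) • d) = √m / t * l2norm d := by
      rw [enorm2_eq_l2norm, l2norm_smul, abs_of_nonneg (by positivity)]
    have h0 : 0 ≤ √(m : ℝ) / t * l2norm d := by have := l2norm_nonneg d; positivity
    rw [h1, div_eq_mul_inv]
    refine S.log_le_of_le (mul_nonneg h0 (inv_pos.2 hacc).le) (le_trans ?_ hVW)
    exact mul_le_mul hV hW (inv_pos.2 hacc).le (h0.trans hV)

lemma inv_newton_acc_le {p : Query n} (hp : p.acc = 1 / (20 * (√(2 * m : ℝ) + 1))) :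
    0 < p.acc ∧ p.acc⁻¹ ≤ 50 * callScale A b c T y0 ε := by
  rw [hp]
  refine ⟨by positivity, ?_⟩
  rw [one_div, inv_inv]
  have h1 : √(2 * m : ℝ) ≤ 3 / 2 * √m := by
    rw [Real.sqrt_le_left (by positivity), mul_pow, Real.sq_sqrt (Nat.cast_nonneg m)]
    linarith [S.two_le_cast]
  have h2 : 1 ≤ √(m : ℝ) := Real.one_le_sqrt.2 (by linarith [S.two_le_cast])
  linarith [S.sqrt_m_le_callScale]

/-- For a gap of order at least `ε`, the rank-one part of a call has norm `O(m U / ε)`. -/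
lemma rankOne_norm_le {t : ℝ} (ht : ε / 5 ≤ t) :
    √m / t * l2norm b ≤ 5 * callScale A b c T y0 ε := by
  have hε := S.eps_pos
  have hU := S.U_pos
  calc √m / t * l2norm b ≤ √m / (ε / 5) * (√m * maxEntry A b c) :=
        mul_le_mul (div_le_div_of_nonneg_left S.sqrt_m_pos.le (by positivity) ht) S.norm_b_le
          (l2norm_nonneg _) (by positivity)
    _ = 5 * (maxEntry A b c * (√m * √m) / ε) := by field_simp
    _ ≤ 5 * (T * maxEntry A b c * m / ε) := by
        rw [sqrt_mul_sqrt_natCast]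
        have := S.U_mul_m_le
        gcongr
    _ ≤ _ := by linarith [S.callScale_facts.2.2.2]

/-- The form of the solver calls made in the first phase. -/
lemma call_form_first {st : PathState n m} {t : ℝ}
    (H : OnPath A (auxObj A c y0) c (1 / 40) st)
    (hd : auxObj A c y0 ⬝ᵥ st.y - auxObj A c y0 ⬝ᵥ y0 ≤ st.gap) (hg : 2 / 5 * m ≤ st.gap)
    (ht : st.gap ≤ t) {p : Query n} (hacc : p.acc = 1 / (20 * (√(2 * m : ℝ) + 1)))
    (hp : p.mat = scaledGram (extMat A (auxObj A c y0)) (extVec st.s t)) :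
    0 < p.acc ∧ ∃ (s : Fin m → ℝ) (v : Fin n → ℝ), (∀ j, 0 < s j) ∧
      p.mat = scaledGram A s + vecMulVec v v ∧
      diagCond s ≤ 2000 * (T ^ 2 * maxEntry A b c * m ^ 2 / (minSlack A c y0 * ε)) ∧
      Real.log (enorm2 v / p.acc) ≤ 2000 * Real.log (callScale A b c T y0 ε) := by
  have hU := S.U_pos
  have hT := S.T_pos
  have hε := S.eps_pos
  have hμ := S.minSlack_pos
  have hm : (0 : ℝ) < m := Nat.cast_pos.2 S.m_pos
  obtain ⟨ha, ha'⟩ := S.inv_newton_acc_le hacc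
  have hK1 := S.one_le_of_sqrt_m_le S.sqrt_m_le_callScale
  set K := callScale A b c T y0 ε with hK
  refine S.call_form H (by norm_num) ?_ hp ha (H.gap_pos.trans_le ht) (V := 5 / 2 * K) ?_ ha' ?_
  · have : 0 ≤ 10 * m * maxEntry A b c * T / ε * st.gap := by have := H.gap_pos; positivity
    linarith
  · calc √m / t * l2norm (auxObj A c y0)
        ≤ √m / (2 / 5 * m) * (√m * (m * maxEntry A b c / minSlack A c y0)) :=
          mul_le_mul (div_le_div_of_nonneg_left S.sqrt_m_pos.le (by positivity) (hg.trans ht))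
            S.norm_auxObj_le (l2norm_nonneg _) (by positivity)
      _ = 5 / 2 * ((√m * √m) * maxEntry A b c / minSlack A c y0) := by field_simp
      _ ≤ 5 / 2 * (T * maxEntry A b c * m / minSlack A c y0) := by
          rw [sqrt_mul_sqrt_natCast, mul_comm (m : ℝ)]
          have := S.U_mul_m_le
          gcongr
      _ ≤ 5 / 2 * K := by linarith [S.callScale_facts.2.2.1]
  · have : K ^ 2 ≤ K ^ 4 := pow_le_pow_right₀ hK1 (by norm_num)
    nlinarith [sq_nonneg K]

lemma objective_diff_le_mul_gap {d : Fin n → ℝ} {h g : ℝ} {st : PathState n m}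
    (H : OnPath A d c h st) (hg : ε / 5 ≤ g) :
    b ⬝ᵥ st.y - b ⬝ᵥ y0 ≤ (1 + 10 * m * maxEntry A b c * T / ε) * g := by
  have hU := S.U_pos
  have hT := S.T_pos
  have hε := S.eps_pos
  have h1 : 2 * m * maxEntry A b c * T ≤ 10 * m * maxEntry A b c * T / ε * g :=
    calc 2 * m * maxEntry A b c * T = 10 * m * maxEntry A b c * T / ε * (ε / 5) := by
          field_simp; ring
      _ ≤ _ := mul_le_mul_of_nonneg_left hg (by positivity)
  linarith [S.objective_diff_le H]

/-- The form of the solver calls made in the second phase. -/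
lemma call_form_second {st : PathState n m} {t : ℝ} (H : OnPath A b c (1 / 12) st)
    (hg : ε / 3 ≤ st.gap) (ht : ε / 5 ≤ t) {p : Query n}
    (hacc : p.acc = 1 / (20 * (√(2 * m : ℝ) + 1)))
    (hp : p.mat = scaledGram (extMat A b) (extVec st.s t)) :
    0 < p.acc ∧ ∃ (s : Fin m → ℝ) (v : Fin n → ℝ), (∀ j, 0 < s j) ∧
      p.mat = scaledGram A s + vecMulVec v v ∧
      diagCond s ≤ 2000 * (T ^ 2 * maxEntry A b c * m ^ 2 / (minSlack A c y0 * ε)) ∧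
      Real.log (enorm2 v / p.acc) ≤ 2000 * Real.log (callScale A b c T y0 ε) := by
  have hε := S.eps_pos
  obtain ⟨ha, ha'⟩ := S.inv_newton_acc_le hacc
  have hK1 := S.one_le_of_sqrt_m_le S.sqrt_m_le_callScale
  refine S.call_form H le_rfl (S.objective_diff_le_mul_gap H (by linarith)) hp ha
    (by linarith) (S.rankOne_norm_le ht) ha' ?_
  set K := callScale A b c T y0 ε with hK
  have : K ^ 2 ≤ K ^ 4 := pow_le_pow_right₀ hK1 (by norm_num)
  nlinarith [sq_nonneg K]

lemma gapBound_pos : 0 < gapBound m lam T b := by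
  have hl := S.sqrt_lam_pos
  have hT := S.T_pos
  have hb := S.norm_b_pos
  have hm : (0 : ℝ) < m := Nat.cast_pos.2 S.m_pos
  rw [gapBound_eq]
  positivity

/-- The accuracy requested in the last call, and the form of that call. The gap is either of order
`ε` or, when no iteration of the second phase was necessary, the initial one. -/
lemma call_form_last {st : PathState n m} (H : OnPath A b c (1 / 12) st)
    (hg : st.gap = gapBound m lam T b ∨ ε / 5 ≤ st.gap) :
    0 < (finalQuery A b c T st).acc ∧ ∃ (s : Fin m → ℝ) (v : Fin n → ℝ), (∀ j, 0 < s j) ∧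
      (finalQuery A b c T st).mat = scaledGram A s + vecMulVec v v ∧
      diagCond s ≤ 2000 * (T ^ 2 * maxEntry A b c * m ^ 2 / (minSlack A c y0 * ε)) ∧
      Real.log (enorm2 v / (finalQuery A b c T st).acc)
        ≤ 2000 * Real.log (callScale A b c T y0 ε) := by
  have hU := S.U_pos
  have hT := S.T_pos
  have hT1 := S.one_le_T
  have hε := S.eps_pos
  have hμ := S.minSlack_pos
  have hb := S.norm_b_pos
  have hl := S.sqrt_lam_pos
  have hm : (0 : ℝ) < m := Nat.cast_pos.2 S.m_pos
  have hn : (0 : ℝ) < n := Nat.cast_pos.2 S.n_pos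
  have hsm := S.sqrt_m_pos
  have hmm := sqrt_mul_sqrt_natCast m
  have hK1 := S.one_le_of_sqrt_m_le S.sqrt_m_le_callScale
  have hKm := S.sqrt_m_le_callScale
  obtain ⟨k1, k2, k3, k4⟩ := S.callScale_facts
  have hV5 : ε / 5 ≤ st.gap → √m / st.gap * l2norm b ≤ 5 * callScale A b c T y0 ε :=
    S.rankOne_norm_le
  set K := callScale A b c T y0 ε with hK
  set U := maxEntry A b c with hUdef
  have hUm : U ≤ T * U * m := by
    refine le_trans ?_ S.U_mul_m_le
    exact le_mul_of_one_le_right hU.le (by linarith [S.two_le_cast])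
  have hd : b ⬝ᵥ st.y - b ⬝ᵥ y0 ≤ (1 + 10 * m * U * T / ε) * st.gap := by
    rcases hg with hg | hg
    · have h1 := S.objective_diff_le_gapBound H
      have : 0 ≤ 10 * m * U * T / ε * st.gap := by have := H.gap_pos; positivity
      rw [← hg] at h1
      linarith
    · exact S.objective_diff_le_mul_gap H hg
  have hV : √m / st.gap * l2norm b ≤ 5 * K := by
    rcases hg with hg | hg
    · rw [hg, gapBound_eq]
      have h1 : √(m : ℝ) / (40 * T * m * l2norm b / √lam) * l2norm b = √lam / (40 * T * √m) := by
        calc √(m : ℝ) / (40 * T * m * l2norm b / √lam) * l2norm b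
            = √m / (40 * T * (√m * √m) * l2norm b / √lam) * l2norm b := by rw [hmm]
          _ = _ := by field_simp
      rw [h1]
      have h2 : √lam / (40 * T * √m) ≤ U := by
        rw [div_le_iff₀ (by positivity)]
        have h3 := S.sqrt_lam_le
        have h4 : √m * U ≤ T * (√m * U) := le_mul_of_one_le_left (by positivity) hT1
        have h5 : 0 ≤ T * (√m * U) := by positivity
        linarith
      linarith
    · exact hV5 hg
  -- every entry of the extended slack vector is at least `T U √m / (24 K³)`
  have hK2 : K ^ 2 ≤ K ^ 3 := pow_le_pow_right₀ hK1 (by norm_num)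
  have hK3 : K ≤ K ^ 3 := le_self_pow₀ hK1 (by norm_num)
  have hK30 : 0 < 24 * K ^ 3 := by positivity
  have hslack : ∀ k, T * U * √m / (24 * K ^ 3) ≤ extVec st.s st.gap k := by
    intro k
    rw [div_le_iff₀ hK30]
    cases k with
    | inl j =>
      have h1 := S.minSlack_le_mul H le_rfl hd j
      change T * U * √m ≤ st.s j * (24 * K ^ 3)
      have h2 : 2 + 10 * m * U * T / ε ≤ 12 * K := by
        have : 10 * m * U * T / ε = 10 * (T * U * m / ε) := by ring
        rw [this]
        linarith
      have h3 : T * U * m ≤ K * minSlack A c y0 := (div_le_iff₀ hμ).1 k3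
      have h4 : (m : ℝ) * (T * U * √m) ≤ m * (st.s j * (24 * K ^ 3)) :=
        calc (m : ℝ) * (T * U * √m) = T * U * m * √m := by ring
          _ ≤ K * minSlack A c y0 * K := mul_le_mul h3 hKm hsm.le (by positivity)
          _ ≤ K * (2 * m * (12 * K) * st.s j) * K := by
              have := H.slack_pos j
              have h5 : minSlack A c y0 ≤ 2 * m * (12 * K) * st.s j := h1.trans (by gcongr)
              gcongr
          _ = _ := by ring
      exact le_of_mul_le_mul_left h4 hm
    | inr j =>
      change T * U * √m ≤ st.gap * (24 * K ^ 3)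
      have hsmm : √(m : ℝ) ≤ m := by
        rw [Real.sqrt_le_left hm.le]
        nlinarith [S.two_le_cast]
      rcases hg with hg | hg
      · have h1 : U ≤ K := hUm.trans k1
        have h2 : U ≤ K * l2norm b := hUm.trans ((div_le_iff₀ hb).1 k2)
        have h3 : U * U ≤ K ^ 3 * l2norm b :=
          calc U * U ≤ K * (K * l2norm b) := mul_le_mul h1 h2 hU.le (by linarith)
            _ = K ^ 2 * l2norm b := by ring
            _ ≤ _ := mul_le_mul_of_nonneg_right hK2 hb.le
        rw [hg, gapBound_eq, div_mul_eq_mul_div, le_div_iff₀ hl]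
        calc T * U * √m * √lam ≤ T * U * √m * (√m * U) :=
              mul_le_mul_of_nonneg_left S.sqrt_lam_le (by positivity)
          _ = T * (√m * √m) * (U * U) := by ring
          _ ≤ T * m * (K ^ 3 * l2norm b) := by
              rw [hmm]; exact mul_le_mul_of_nonneg_left h3 (by positivity)
          _ ≤ 960 * (T * m * (K ^ 3 * l2norm b)) := le_mul_of_one_le_left (by positivity)
              (by norm_num)
          _ = _ := by ring
      · have h1 : T * U * m ≤ K * ε := (div_le_iff₀ hε).1 k4
        calc T * U * √m ≤ T * U * m := mul_le_mul_of_nonneg_left hsmm (by positivity)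
          _ ≤ K * ε := h1
          _ ≤ K ^ 3 * (5 * st.gap) := mul_le_mul hK3 (by linarith) hε.le (by positivity)
          _ ≤ st.gap * (24 * K ^ 3) := by
              have : 0 < K ^ 3 * st.gap := mul_pos (by positivity) H.gap_pos
              linarith
  have hne : Nonempty (Fin m ⊕ Fin m) := ⟨Sum.inl ⟨0, S.m_pos⟩⟩
  have hinf : T * U * √m / (24 * K ^ 3) ≤ ⨅ k, extVec st.s st.gap k := le_ciInf hslack
  have hacc : (24 * K ^ 3)⁻¹ ≤ (finalQuery A b c T st).acc := by
    refine le_min ?_ ?_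
    · exact inv_le_one_of_one_le₀ (by linarith)
    · calc (24 * K ^ 3)⁻¹ = T * U * √m / (24 * K ^ 3) / (T * U) * (√m / (√m * √m)) := by
            field_simp
        _ = T * U * √m / (24 * K ^ 3) / (T * U) * (√m / m) := by rw [hmm]
        _ ≤ _ := by
            have hn' := S.n_le_m
            have h0 : 0 ≤ (⨅ k, extVec st.s st.gap k) / (T * maxEntry A b c) :=
              div_nonneg (le_trans (by positivity) hinf) (mul_pos hT hU).le
            gcongr
  have hacc0 : 0 < (finalQuery A b c T st).acc := (inv_pos.2 hK30).trans_le hacc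
  refine S.call_form H le_rfl hd rfl hacc0 H.gap_pos hV (W := 24 * K ^ 3) ?_ ?_
  · exact inv_le_of_inv_le₀ hK30 hacc
  · have : 0 ≤ K ^ 4 := by positivity
    linarith [show 5 * K * (24 * K ^ 3) = 120 * K ^ 4 by ring]

/-- Both phases need only change the gap by a factor polynomial in the scale `L`: the ratios are at
most `100 L²` and `300 L²`, and `512 ≤ L¹⁸`. -/
lemma phase_bounds :
    gapBound m lam T (auxObj A c y0)
      ≤ 2 / 5 * (m * Real.exp (20 * Real.log (iterScale A b c lam T y0 ε))) ∧
    15 / 2 * gapBound m lam T b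
      ≤ ε * Real.exp (20 * Real.log (iterScale A b c lam T y0 ε)) := by
  have hU := S.U_pos
  have hT := S.T_pos
  have hε := S.eps_pos
  have hμ := S.minSlack_pos
  have hμ1 := S.min_one_minSlack_pos
  have hl := S.sqrt_lam_pos
  have hm : (0 : ℝ) < m := Nat.cast_pos.2 S.m_pos
  have hL := S.sqrt_m_le_iterScale
  have hL1 := S.one_le_of_sqrt_m_le hL
  have hL18 := S.const_le_pow hL
  have i1 : T * maxEntry A b c * m / (√lam * minSlack A c y0) ≤ iterScale A b c lam T y0 ε := by
    refine S.le_iterScale ?_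
    refine (mul_le_of_le_one_right (by positivity) S.eps_lt.le).trans ?_
    exact mul_le_mul_of_nonneg_left (min_le_right _ _) hl.le
  have i2 : T * maxEntry A b c * m / (√lam * ε) ≤ iterScale A b c lam T y0 ε := by
    refine S.le_iterScale (mul_le_mul_of_nonneg_right ?_ hε.le)
    exact mul_le_of_le_one_right hl.le (min_le_left _ _)
  set L := iterScale A b c lam T y0 ε with hLdef
  have hexp : Real.exp (20 * Real.log L) = L ^ 18 * L ^ 2 := by
    rw [mul_comm, Real.exp_mul, Real.exp_log (by linarith), ← pow_add]
    exact_mod_cast Real.rpow_natCast L 20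
  have hL512 : 512 * L ^ 2 ≤ L ^ 18 * L ^ 2 := mul_le_mul_of_nonneg_right hL18 (sq_nonneg L)
  rw [hexp]
  constructor
  · rw [gapBound, enorm2_eq_l2norm]
    calc 40 * (√lam)⁻¹ * T * m * l2norm (auxObj A c y0)
        ≤ 40 * (√lam)⁻¹ * T * m * (√m * (m * maxEntry A b c / minSlack A c y0)) :=
          mul_le_mul_of_nonneg_left S.norm_auxObj_le (by positivity)
      _ = 40 * m * (√m * (T * maxEntry A b c * m / (√lam * minSlack A c y0))) := by field_simp
      _ ≤ 40 * m * (L * L) := by gcongr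
      _ = m * (40 * L ^ 2) := by ring
      _ ≤ m * (2 / 5 * (L ^ 18 * L ^ 2)) :=
          mul_le_mul_of_nonneg_left (by linarith [sq_nonneg L]) hm.le
      _ = _ := by ring
  · rw [gapBound, enorm2_eq_l2norm]
    calc 15 / 2 * (40 * (√lam)⁻¹ * T * m * l2norm b)
        ≤ 15 / 2 * (40 * (√lam)⁻¹ * T * m * (√m * maxEntry A b c)) := by
          have := S.norm_b_le
          gcongr
      _ = ε * (300 * (√m * (T * maxEntry A b c * m / (√lam * ε)))) := by field_simp; norm_num
      _ ≤ ε * (300 * (L * L)) := by gcongr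
      _ = ε * (300 * L ^ 2) := by ring
      _ ≤ _ := mul_le_mul_of_nonneg_left (by linarith [sq_nonneg L]) hε.le

/-- Additive constants are absorbed by `√m log L`, since `L ≥ √m ≥ √2`. -/
lemma one_third_le : 1 / 3 ≤ √m * Real.log (iterScale A b c lam T y0 ε) := by
  have hL := S.sqrt_m_le_iterScale
  have hL1 := S.one_le_of_sqrt_m_le hL
  have h1 := Real.log_le_log (by norm_num) (S.two_le_sq hL)
  rw [Real.log_pow] at h1
  push_cast at h1
  have h2 := Real.log_two_gt_d9
  have h3 : 1 ≤ √(m : ℝ) := Real.one_le_sqrt.2 (by linarith [S.two_le_cast])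
  have h4 : 1 / 3 ≤ Real.log (iterScale A b c lam T y0 ε) := by linarith
  exact h4.trans (le_mul_of_one_le_left (by linarith) h3)

end Setting

end Magnitudes

end InteriorPt

theorem mainTheorem2 :
    ∃ C : ℝ, 0 < C ∧
      ∀ (n m : ℕ) (A : Matrix (Fin n) (Fin m) ℝ) (b : Fin n → ℝ) (c : Fin m → ℝ)
        (lam T : ℝ) (y0 : Fin n → ℝ) (ε : ℝ) (solve : InteriorPt.Solver n)
        (hA : (A * Aᵀ).PosDef),
        b ≠ 0 →
        0 < lam → (∀ i, lam ≤ hA.isHermitian.eigenvalues i) →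
        1 ≤ T →
        (∀ (y : Fin n → ℝ) (s : Fin m → ℝ), s = c - Aᵀ *ᵥ y → (∀ j, 0 ≤ s j) →
          (∀ i, |y i| ≤ T) ∧ ∀ j, |s j| ≤ T) →
        (∀ j, (Aᵀ *ᵥ y0) j < c j) →
        0 < ε → ε < 1 →
        InteriorPt.IsApproxSolver solve →
        ∃ (x : Fin m → ℝ) (calls : List (InteriorPt.Query n)) (q : InteriorPt.Query n)
          (zstar : ℝ),
          InteriorPt.InteriorPointRun solve A b c lam T y0 ε x calls q ∧
          -- the output
          IsLeast (InteriorPt.primalValues A b c) zstar ∧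
          IsGreatest (InteriorPt.dualValues A b c) zstar ∧
          (∀ j, 0 < x j) ∧
          InteriorPt.enorm2 (A *ᵥ x - b) ≤ ε ∧
          c ⬝ᵥ x < zstar + ε ∧
          -- the number of solver calls
          (((calls ++ [q]).length : ℕ) : ℝ) ≤
            C * (√(m : ℝ) * Real.log (T * InteriorPt.maxEntry A b c * m /
              (√lam * min 1 (InteriorPt.minSlack A c y0) * ε))) ∧
          -- the accuracy requested in all calls but the last
          (∀ p ∈ calls, p.acc = 1 / (20 * (√(2 * m : ℝ) + 1))) ∧
          -- the form of the solver calls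
          ∀ p ∈ calls ++ [q], 0 < p.acc ∧ ∃ (s : Fin m → ℝ) (v : Fin n → ℝ),
            (∀ j, 0 < s j) ∧
            p.mat = InteriorPt.scaledGram A s + Matrix.vecMulVec v v ∧
            InteriorPt.diagCond s ≤
              C * (T ^ 2 * InteriorPt.maxEntry A b c * m ^ 2 /
                (InteriorPt.minSlack A c y0 * ε)) ∧
            Real.log (InteriorPt.enorm2 v / p.acc) ≤
              C * Real.log (T * InteriorPt.maxEntry A b c * m /
                (min 1 (InteriorPt.minSlack A c y0) * min ε (InteriorPt.enorm2 b))) := by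
  refine ⟨2000, by norm_num, ?_⟩
  intro n m A b c lam T y0 ε solve hA hb hlam hev hT1 hT hy0 hε hε1 hsolve
  have S : InteriorPt.Setting A b c lam T y0 ε := ⟨hA, hb, hlam, hev, hT1, hT, hy0, hε, hε1⟩
  obtain ⟨zs, hz⟩ := InteriorPt.exists_isGreatest_dualValues hT hy0 b
  have hL1 := S.one_le_of_sqrt_m_le S.sqrt_m_le_iterScale
  obtain ⟨hph1, hph2⟩ := S.phase_bounds
  have hthird := S.one_third_le
  set Λ := 20 * Real.log (InteriorPt.iterScale A b c lam T y0 ε) with hΛdef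
  have hΛ : 0 ≤ Λ := mul_nonneg (by norm_num) (Real.log_nonneg hL1)
  obtain ⟨st', hrun1, hon1, hgap1, hlen1, hcalls1⟩ :=
    InteriorPt.exists_centralPath_run S.m_pos S.injective hsolve hT hy0 rfl hΛ hph1
  -- the first phase hands over its point with the gap of the second phase
  set g := InteriorPt.gapBound m lam T b with hg
  set st₁ : InteriorPt.PathState n m :=
    { y := st'.y
      s := st'.s
      gap := b ⬝ᵥ st'.y - (b ⬝ᵥ st'.y - g)
      z := b ⬝ᵥ st'.y - g
      calls := st'.calls } with hst₁
  have hgap₁ : st₁.gap = g := by rw [hst₁]; ring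
  have hon2 : InteriorPt.OnPath A b c (1 / 12) st₁ := by
    refine ⟨hon1.slack, rfl, hon1.slack_pos, by rw [hgap₁]; exact S.gapBound_pos, ?_⟩
    rw [hgap₁]
    exact InteriorPt.OnPath.change_objective (st := st') S.m_pos hA hlam hev hT1 hT hb hon1 hgap1
  obtain ⟨st₂, hrun2, hon3, hgap2, hcase, hlen2, hcalls2⟩ :=
    InteriorPt.exists_shift_run S.m_pos S.injective hsolve hz hon2 hΛ (by rw [hgap₁]; exact hph2)
  -- either no iteration was made and the gap is the initial one, or it is of order `ε`
  have hlast := S.call_form_last hon3 (hcase.imp_left fun h => by rw [h, hgap₁])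
  have hout := InteriorPt.primalOutput_spec S.n_pos S.m_pos S.injective hsolve hT1 hT S.U_pos
    (fun i j => InteriorPt.abs_le_maxEntry_matrix (A := A) (b := b) (c := c) i j)
    (fun i => InteriorPt.abs_le_maxEntry_objective (A := A) (b := b) (c := c) i) hon3
    (σ := ⨅ k, InteriorPt.extVec st₂.s st₂.gap k)
    (by
      have hne : Nonempty (Fin m ⊕ Fin m) := ⟨Sum.inl ⟨0, S.m_pos⟩⟩
      obtain ⟨k, hk⟩ := exists_eq_ciInf_of_finite (f := InteriorPt.extVec st₂.s st₂.gap)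
      rw [← hk]
      exact InteriorPt.extVec_pos hon3.slack_pos hon3.gap_pos k)
    (fun k => ciInf_le (Set.finite_range _).bddBelow k)
    hlast.1 (min_le_left _ _) (min_le_right _ _) rfl
  obtain ⟨hx0, hxA, hxc⟩ := hout
  refine ⟨_, st₂.calls, InteriorPt.finalQuery A b c T st₂, zs,
    ⟨st₁, st₂, ⟨st', hrun1, rfl⟩, hrun2, rfl, rfl, rfl⟩,
    InteriorPt.isLeast_primalValues hT hy0 hz, hz, hx0, ?_, ?_, ?_, ?_, ?_⟩
  · rw [InteriorPt.enorm2_eq_l2norm]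
    refine hxA.trans ?_
    linarith
  · have := hz.2 hon3.mem_dualValues
    refine hxc.trans_lt ?_
    linarith
  · rw [List.length_append, List.length_singleton]
    push_cast
    change _ ≤ 2000 * (√(m : ℝ) * Real.log (InteriorPt.iterScale A b c lam T y0 ε))
    have h1 : (st₁.calls.length : ℝ) = st'.calls.length := rfl
    have h2 : √(m : ℝ) * Λ = 20 * (√m * Real.log (InteriorPt.iterScale A b c lam T y0 ε)) := by
      rw [hΛdef]; ring
    linarith
  · intro p hp
    rcases hcalls2 p hp with h | h
    · exact (hcalls1 p h).1
    · exact h.1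
  · intro p hp
    rcases List.mem_append.1 hp with hp | hp
    · rcases hcalls2 p hp with h | ⟨hacc, st, t, h1, h2, h3, h4⟩
      · obtain ⟨hacc, st, t, h1, h2, h3, h4, h5⟩ := hcalls1 p h
        exact S.call_form_first h1 h2 h3 h4 hacc h5
      · exact S.call_form_second h1 h2 h3 hacc h4
    · rw [List.mem_singleton.1 hp]
      exact hlast
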